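/- Let $p\ge 2$ be even. For $N\ge1$ and $\sigma\in\{-1,1\}^N$ let $$H_N(\sigma,J)=-\sqrt{\frac{p!}{2N^{p-1}}}\sum_{1\le i_1<\dots<i_p\le N}J_{i_1\dots i_p}\,\sigma_{i_1}\cdots\sigma_{i_p},$$ where the $J_{i_1\dots i_p}$ are independent standard Gaussian random variables. For $\beta>0$ and a function $G$ of $n$ configurations (replicas) $\sigma^1,\dots,\sigma^n$, let $\langle G\rangle=\langle G\rangle_{N,\beta}=\mathbb E\,\Omega(G)$, where $\mathbb E$ is the expectation over $J$ and $$\Omega(G)=Z_N^{-n}\sum_{\sigma^1,\dots,\sigma^n}G(\sigma^1,\dots,\sigma^n)\,e^{-\beta\sum_{a=1}^nH_N(\sigma^a,J)},\qquad Z_N=\sum_\sigma e^{-\beta H_N(\sigma,J)}.$$ Let $q_{ab}=\frac1N\sum_{i=1}^N\sigma^a_i\sigma^b_i$ be the overlap of the replicas $a$ and $b$. A monomial $F_s=\prod_{1\le a<b\le s}q_{ab}^{m_{ab}}$ ($m_{ab}\in\mathbb N$) in the overlaps among $s$ replicas is called filled if every replica $a\in\{1,\dots,s\}$ appears in it an even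 number of times, i.e. $\sum_{b<a}m_{ba}+\sum_{b>a}m_{ab}$ is even. Then for almost every $\beta>0$ (with respect to Lebesgue measure) the following hold. (1) (Aizenman–Contucci identities) For every $s$ and every filled monomial $F_s$ of the overlaps among $s$ replicas, $$\lim_{N\to\infty}\Big\langle F_s\Big(\sum_{1\le a<b\le s}q_{ab}^p-s\sum_{1\le a\le s}q_{a,s+1}^p+\frac{s(s+1)}2\,q_{s+1,s+2}^p\Big)\Big\rangle=0 .$$ (2) In particular $$\lim_{N\to\infty}\Big(\langle q_{12}^{2p}\rangle-4\langle q_{12}^pq_{13}^p\rangle+3\langle q_{12}^pq_{34}^p\rangle\Big)=0 .$$ (3) (Ghirlanda–Guerra identities) For every $s$, every real function $F_s$ of the overlaps $(q_{ab})_{1\le a,b\le s}$ among $s$ replicas that is bounded on arrays with entries in $[-1,1]$, and every $1\le a\le s$, $$\lim_{N\to\infty}\Big\langle F_s\Big(\sum_{1\le b\le s}q_{ab}^p-s\,q_{a,s+1}^p-\big(1-\langle q_{12}^p\rangle\big)\Big)\Big\rangle=0,$$ and, for every $s$ and every such $F_s$, $$\lim_{N\to\infty}\Big\langle F_s\Big(\sum_{1\le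 b\le s}q_{b,s+1}^p+\langle q_{12}^p\rangle-(s+1)\,q_{s+1,s+2}^p\Big)\Big\rangle=0 .$$ -/

import Mathlib

open MeasureTheory ProbabilityTheory Filter Topology

noncomputable section

namespace PSpin

/-- Configurations of `N` Ising spins; a spin is a unit `±1` of `ℤ`. -/
abbrev Config (N : ℕ) : Type := Fin N → ℤˣ

/-- The real value `±1` of the spin at site `i`. -/
def spin {N : ℕ} (σ : Config N) (i : Fin N) : ℝ := ((σ i : ℤ) : ℝ)

/-- The index sets `{i₁ < ⋯ < i_p}` of the interactions. -/
abbrev Tuple (N p : ℕ) : Type := {A : Finset (Fin N) // A.card = p}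

/-- The law of the couplings: independent standard Gaussians, one for each `i₁ < ⋯ < i_p`. -/
def disorder (N p : ℕ) : Measure (Tuple N p → ℝ) :=
  Measure.pi fun _ => gaussianReal 0 1

/-- The Hamiltonian
`H_N(σ, J) = -√(p! / (2 N^(p-1))) ∑_{i₁ < ⋯ < i_p} J_{i₁ ⋯ i_p} σ_{i₁} ⋯ σ_{i_p}`. -/
def hamiltonian {N p : ℕ} (J : Tuple N p → ℝ) (σ : Config N) : ℝ :=
  -Real.sqrt ((p.factorial : ℝ) / (2 * (N : ℝ) ^ (p - 1))) *
    ∑ A : Tuple N p, J A * ∏ i ∈ A.1, spin σ i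

/-- The partition function at inverse temperature `β`. -/
def partitionFunction {N p : ℕ} (β : ℝ) (J : Tuple N p → ℝ) : ℝ :=
  ∑ σ : Config N, Real.exp (-β * hamiltonian J σ)

/-- The Boltzmann average `Ω` of an observable of `n` independent replicas with the same
disorder `J`. -/
def boltzmann {N p n : ℕ} (β : ℝ) (J : Tuple N p → ℝ) (G : (Fin n → Config N) → ℝ) : ℝ :=
  (∑ σ : Fin n → Config N, G σ * Real.exp (∑ a, -β * hamiltonian J (σ a))) /
    partitionFunction β J ^ n

/-- The overlap `q = N⁻¹ ∑ᵢ σᵢ σᵢ'` of two configurations. -/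
def overlap {N : ℕ} (σ σ' : Config N) : ℝ :=
  (∑ i, spin σ i * spin σ' i) / N

/-- The quenched average `⟨G⟩ = 𝔼 Ω(G)` of a function `G` of the overlaps `q a b` of `n`
replicas. -/
def average (N p : ℕ) (β : ℝ) {n : ℕ} (G : (Fin n → Fin n → ℝ) → ℝ) : ℝ :=
  ∫ J, boltzmann β J (fun σ : Fin n → Config N => G fun a b => overlap (σ a) (σ b))
    ∂(disorder N p)

/-- The monomial `∏_{a < b} q_{ab}^(m a b)` in the overlaps of `s` replicas. Only the exponents
`m a b` with `a < b` matter. -/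
def monomial {s : ℕ} (m : Fin s → Fin s → ℕ) (q : Fin s → Fin s → ℝ) : ℝ :=
  ∏ a, ∏ b ∈ Finset.Ioi a, q a b ^ m a b

/-- A monomial is filled if every replica appears in it an even number of times. -/
def IsFilled {s : ℕ} (m : Fin s → Fin s → ℕ) : Prop :=
  ∀ a, Even (∑ b ∈ Finset.Ioi a, m a b + ∑ b ∈ Finset.Iio a, m b a)

/-- Among `s + 2` replicas, the replica `a ∈ {1, …, s}`. -/
def old {s : ℕ} (a : Fin s) : Fin (s + 2) := Fin.castAdd 2 a

/-- Replica `s + 1` among `s + 2` replicas. -/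
def new₁ (s : ℕ) : Fin (s + 2) := Fin.natAdd s 0

/-- Replica `s + 2` among `s + 2` replicas. -/
def new₂ (s : ℕ) : Fin (s + 2) := Fin.natAdd s 1

/-- The overlaps of the first `s` of `s + 2` replicas. -/
def restrict {s : ℕ} (q : Fin (s + 2) → Fin (s + 2) → ℝ) : Fin s → Fin s → ℝ :=
  fun a b => q (old a) (old b)

/-- A function of the overlaps of `s` replicas that is bounded on the range `[-1, 1]` of the
overlaps. -/
def IsBoundedObservable {s : ℕ} (F : (Fin s → Fin s → ℝ) → ℝ) : Prop :=
  ∃ C : ℝ, ∀ q : Fin s → Fin s → ℝ, (∀ a b, |q a b| ≤ 1) → |F q| ≤ C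

end PSpin

end

/-!
Let `h` be minus the energy per spin. The identities all follow from one fact: at almost every `β`,
the energy of a replica is asymptotically uncorrelated with every bounded observable,
`⟨F h(σᵃ)⟩ - ⟨F⟩⟨h⟩ → 0`. Gaussian integration by parts (`integral_gibbs_mul_field`) turns both
terms into polynomials in covariances of the energy, and these are `N q ^ p / 2` up to a bounded
error (`abs_crossCov_couplingCoeff_sub_le`). The result is the first Ghirlanda-Guerra identity; the
second one is the first for the replica `s + 1`, on which `F` does not depend, and a linear
combination of the two gives the Aizenman-Contucci identities (`stabilityObservable_eq`).

Decorrelation is proved without separating thermal fluctuations from those of the disorder. For a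
density `G` with values in `[1, 3]`, Jensen's inequality (`gibbs_mul_le`) bounds the energy of a
replica under the tilted Gibbs measure by the difference quotient of `log Z` in `β`, up to a
relative entropy of at most `log 3`. An Efron-Stein inequality
(`integral_sub_integral_sq_le_of_coordinate_lipschitz`) shows that `log Z` is within `O(√N)` of its
mean, so the quenched average of `G h(σᵃ)` is at most that of `G` times a difference quotient of the
mean free energy `ψ_N`, up to `O(1 / √N)`. For `G = 2 ± F`, and with the mean of `h` between the left
and right difference quotients of `ψ_N`, the correlation is at most three times the symmetric second
difference `(ψ_N(β + t) + ψ_N(β - t) - 2 ψ_N(β)) / t`, up to `O(1 / √N)` for fixed `t`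
(`abs_quenchedEnergy_sub_le`).

It remains to let `N → ∞` and then `t → 0`. The limit `ψ` of `ψ_N` exists by Fekete's lemma, because
the free energy is superadditive up to a constant (`modelFreeEnergy_add_le`). This is the
Guerra-Toninelli argument: a Gaussian comparison (`freeEnergy_le_of_cov_le`) between the system and
two independent blocks, for which `q ^ p` is convex since `p` is even. As `ψ` is monotone on the
positive axis, it is differentiable almost everywhere, and there its symmetric second difference
tends to `0`.
-/

open MeasureTheory ProbabilityTheory Filter Topology

namespace PSpin

/-! ### Standard Gaussian vectors: integration by parts and a variance bound -/

/-- The standard Gaussian measure on `ι → ℝ`. -/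
noncomputable abbrev stdGaussian (ι : Type*) [Fintype ι] : Measure (ι → ℝ) :=
  Measure.pi fun _ => gaussianReal 0 1

/-- Gaussian integration by parts in one variable: the density `g` satisfies `g' x = -x g x`. -/
theorem integral_id_mul_gaussianReal {f f' : ℝ → ℝ} {C : ℝ}
    (hf : ∀ x, HasDerivAt f (f' x) x) (hf' : Continuous f')
    (hC : ∀ x, |f x| ≤ C) (hC' : ∀ x, |f' x| ≤ C) :
    ∫ x, x * f x ∂gaussianReal 0 1 = ∫ x, f' x ∂gaussianReal 0 1 := by
  have h1 : (1 : NNReal) ≠ 0 := one_ne_zero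
  have hfc : Continuous f := continuous_iff_continuousAt.2 fun x => (hf x).continuousAt
  rw [integral_gaussianReal_eq_integral_smul h1, integral_gaussianReal_eq_integral_smul h1]
  have hpdf : ∀ x, HasDerivAt (fun x => -gaussianPDFReal 0 1 x) (x * gaussianPDFReal 0 1 x) x := by
    intro x
    simp only [gaussianPDFReal_def]
    have h2 : HasDerivAt (fun x : ℝ => -(x - 0) ^ 2 / (2 * ((1 : NNReal) : ℝ))) (-x) x := by
      have := (((hasDerivAt_id x).sub_const 0).pow 2).neg.div_const (2 * ((1 : NNReal) : ℝ))
      refine this.congr_deriv ?_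
      simp
      ring
    have h3 := (h2.exp.const_mul (√(2 * Real.pi * ((1 : NNReal) : ℝ)))⁻¹).neg
    refine h3.congr_deriv ?_
    ring
  have hg : Integrable (gaussianPDFReal 0 1) := integrable_gaussianPDFReal 0 1
  have hxg : Integrable (fun x => x * gaussianPDFReal 0 1 x) := by
    have h := (memLp_id_gaussianReal (μ := 0) (v := 1) 1).integrable le_rfl
    rw [gaussianReal_of_var_ne_zero _ h1,
      integrable_withDensity_iff_integrable_smul₀' (measurable_gaussianPDF 0 1).aemeasurable
        (ae_of_all _ fun x => gaussianPDF_lt_top)] at h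
    refine h.congr (ae_of_all _ fun x => ?_)
    simp [toReal_gaussianPDF, mul_comm]
  have key := integral_mul_deriv_eq_deriv_mul_of_integrable (u := f) (u' := f')
    (v := fun x => -gaussianPDFReal 0 1 x) (v' := fun x => x * gaussianPDFReal 0 1 x)
    (fun x _ => hf x) (fun x _ => hpdf x) ?_ ?_ ?_
  · rw [← integral_neg] at key
    refine Eq.trans (integral_congr_ae (ae_of_all _ fun x => ?_)) (key.trans
      (integral_congr_ae (ae_of_all _ fun x => ?_)))
    · simp only [smul_eq_mul]; ring
    · simp only [smul_eq_mul]; ring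
  · exact hxg.bdd_mul (c := C) hfc.aestronglyMeasurable (ae_of_all _ hC)
  · exact hg.neg.bdd_mul (c := C) hf'.aestronglyMeasurable (ae_of_all _ hC')
  · exact hg.neg.bdd_mul (c := C) hfc.aestronglyMeasurable (ae_of_all _ hC)

variable {ι κ : Type*} [Fintype ι] [Fintype κ]

/-- Resampling one coordinate does not change the law of a standard Gaussian vector. -/
theorem measurePreserving_update_stdGaussian [DecidableEq ι] (i : ι) :
    MeasurePreserving (fun z : ℝ × (ι → ℝ) => Function.update z.2 i z.1)
      ((gaussianReal 0 1).prod (stdGaussian ι)) (stdGaussian ι) := by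
  have hm : Measurable (fun z : ℝ × (ι → ℝ) => Function.update z.2 i z.1) := by
    refine measurable_pi_iff.2 fun j => ?_
    by_cases h : j = i
    · subst h; simpa using measurable_fst
    · simp only [Function.update_of_ne h]; fun_prop
  refine ⟨hm, (Measure.pi_eq fun s hs => ?_).symm⟩
  rw [Measure.map_apply hm (MeasurableSet.univ_pi hs)]
  have : (fun z : ℝ × (ι → ℝ) => Function.update z.2 i z.1) ⁻¹' Set.univ.pi s
      = s i ×ˢ Set.univ.pi (Function.update s i Set.univ) := by
    ext z
    simp only [Set.mem_preimage, Set.mem_pi, Set.mem_univ, true_imp_iff, Set.mem_prod]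
    constructor
    · intro h
      refine ⟨by simpa using h i, fun j => ?_⟩
      by_cases hj : j = i
      · subst hj; simp
      · simpa [hj] using h j
    · rintro ⟨h1, h2⟩ j
      by_cases hj : j = i
      · subst hj; simpa using h1
      · simpa [hj] using h2 j
  rw [this, Measure.prod_prod, Measure.pi_pi, ← Finset.mul_prod_erase _ _ (Finset.mem_univ i),
    ← Finset.mul_prod_erase _ (fun j => gaussianReal 0 1 (s j)) (Finset.mem_univ i)]
  simp only [Function.update_self, measure_univ, one_mul]
  congr 1
  refine Finset.prod_congr rfl fun j hj => ?_
  rw [Function.update_of_ne (Finset.ne_of_mem_erase hj)]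

theorem memLp_eval_stdGaussian (i : ι) : MemLp (fun J : ι → ℝ => J i) 2 (stdGaussian ι) :=
  (memLp_id_gaussianReal (μ := 0) (v := 1) 2).comp_measurePreserving
    (measurePreserving_eval (fun _ : ι => gaussianReal 0 1) i)

theorem integrable_eval_stdGaussian (i : ι) :
    Integrable (fun J : ι → ℝ => J i) (stdGaussian ι) :=
  (memLp_eval_stdGaussian i).integrable (by norm_num)

/-- **Gaussian integration by parts** in one coordinate. -/
theorem integral_eval_mul_stdGaussian [DecidableEq ι] (i : ι) {f f' : (ι → ℝ) → ℝ} {C : ℝ}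
    (hf : ∀ J x, HasDerivAt (fun y => f (Function.update J i y)) (f' (Function.update J i x)) x)
    (hfc : Continuous f) (hf' : Continuous f')
    (hC : ∀ x, |f x| ≤ C) (hC' : ∀ x, |f' x| ≤ C) :
    ∫ J, J i * f J ∂stdGaussian ι = ∫ J, f' J ∂stdGaussian ι := by
  have hmp := measurePreserving_update_stdGaussian i
  have hi1 : Integrable (fun J : ι → ℝ => J i * f J) (stdGaussian ι) :=
    (integrable_eval_stdGaussian i).mul_bdd (c := C) hfc.aestronglyMeasurable (ae_of_all _ hC)
  have hi2 : Integrable f' (stdGaussian ι) :=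
    Integrable.of_bound hf'.aestronglyMeasurable C (ae_of_all _ hC')
  rw [← hmp.map_eq, integral_map hmp.measurable.aemeasurable (by
      rw [hmp.map_eq]; exact hi1.aestronglyMeasurable),
    integral_map hmp.measurable.aemeasurable (by
      rw [hmp.map_eq]; exact hi2.aestronglyMeasurable),
    integral_prod_symm (fun z : ℝ × (ι → ℝ) => Function.update z.2 i z.1 i *
      f (Function.update z.2 i z.1)) (hmp.integrable_comp_of_integrable hi1),
    integral_prod_symm (fun z : ℝ × (ι → ℝ) => f' (Function.update z.2 i z.1))
      (hmp.integrable_comp_of_integrable hi2)]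
  refine integral_congr_ae (ae_of_all _ fun J => ?_)
  simp only [Function.update_self]
  exact integral_id_mul_gaussianReal (hf J) (hf'.comp (continuous_const.update i continuous_id))
    (fun _ => hC _) (fun _ => hC' _)


/-- Decomposition of the mean square deviation from a constant. -/
theorem integral_sub_const_sq {Ω : Type*} [MeasurableSpace Ω] {μ : Measure Ω}
    [IsProbabilityMeasure μ] {f : Ω → ℝ} (hf : MemLp f 2 μ) (a : ℝ) :
    ∫ x, (f x - a) ^ 2 ∂μ = ∫ x, (f x - ∫ y, f y ∂μ) ^ 2 ∂μ + (∫ y, f y ∂μ - a) ^ 2 := by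
  have hfa : MemLp (fun x => f x - a) 2 μ := hf.sub (memLp_const a)
  have h1 := variance_eq_sub hfa
  rw [variance_sub_const hf.aestronglyMeasurable a, variance_eq_integral hf.aemeasurable,
    integral_sub (hf.integrable (by norm_num)) (integrable_const a)] at h1
  simp only [Pi.pow_apply, integral_const, probReal_univ, one_smul] at h1
  linarith

theorem abs_le_of_coordinate_lipschitz {f : (ι → ℝ) → ℝ} {c : ι → ℝ}
    (hf : ∀ x y, |f x - f y| ≤ ∑ i, c i * |x i - y i|) (x : ι → ℝ) :
    |f x| ≤ |f 0| + ∑ i, c i * |x i| := by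
  have := hf x 0
  simp only [Pi.zero_apply, sub_zero] at this
  have h2 := abs_sub_abs_le_abs_sub (f x) (f 0)
  linarith

theorem continuous_of_coordinate_lipschitz {f : (ι → ℝ) → ℝ} {c : ι → ℝ}
    (hf : ∀ x y, |f x - f y| ≤ ∑ i, c i * |x i - y i|) : Continuous f := by
  refine continuous_iff_continuousAt.2 fun y => ?_
  rw [ContinuousAt, tendsto_iff_dist_tendsto_zero]
  refine squeeze_zero (fun _ => dist_nonneg) (fun x => (hf x y)) ?_
  have : Continuous fun x : ι → ℝ => ∑ i, c i * |x i - y i| := by fun_prop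
  simpa using this.tendsto y

theorem memLp_of_coordinate_lipschitz {f : (ι → ℝ) → ℝ} {c : ι → ℝ}
    (hf : ∀ x y, |f x - f y| ≤ ∑ i, c i * |x i - y i|) : MemLp f 2 (stdGaussian ι) := by
  have hs : ∀ i, MemLp (fun x : ι → ℝ => c i * |x i|) 2 (stdGaussian ι) := fun i =>
    (memLp_eval_stdGaussian i).norm.const_mul (c i)
  have h : MemLp (fun x : ι → ℝ => |f 0| + ∑ i, c i * |x i|) 2 (stdGaussian ι) :=
    (memLp_const |f 0|).add (memLp_finsetSum Finset.univ fun i _ => hs i)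
  exact h.of_le (continuous_of_coordinate_lipschitz hf).aestronglyMeasurable
    (ae_of_all _ fun x => (abs_le_of_coordinate_lipschitz hf x).trans (le_abs_self _))

/-- The Efron-Stein bound on the variance of a coordinatewise Lipschitz function of `ι` independent
Gaussians, as a property of the index type: it is proved by induction on the number of
coordinates. -/
def VarianceBound (ι : Type*) [Fintype ι] : Prop :=
  ∀ (f : (ι → ℝ) → ℝ) (c : ι → ℝ), (∀ x y, |f x - f y| ≤ ∑ i, c i * |x i - y i|) →
    ∫ x, (f x - ∫ y, f y ∂stdGaussian ι) ^ 2 ∂stdGaussian ι ≤ ∑ i, c i ^ 2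

theorem VarianceBound.of_equiv (e : ι ≃ κ) (h : VarianceBound ι) : VarianceBound κ := by
  intro f c hf
  have hmp : MeasurePreserving (MeasurableEquiv.piCongrLeft (fun _ : κ => ℝ) e)
      (stdGaussian ι) (stdGaussian κ) :=
    measurePreserving_piCongrLeft (fun _ : κ => gaussianReal 0 1) e
  have hap : ∀ (x : ι → ℝ) (i : ι), MeasurableEquiv.piCongrLeft (fun _ : κ => ℝ) e x (e i) = x i :=
    fun x i => Equiv.piCongrLeft_apply_apply (fun _ : κ => ℝ) e x i
  have key := h (fun x => f (MeasurableEquiv.piCongrLeft (fun _ : κ => ℝ) e x)) (fun i => c (e i))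
    (fun x y => by
      refine (hf _ _).trans_eq ?_
      rw [← e.sum_comp]
      simp only [hap])
  rw [hmp.integral_comp' f, e.sum_comp (fun i => c i ^ 2),
    hmp.integral_comp' (fun x => (f x - ∫ y, f y ∂stdGaussian κ) ^ 2)] at key
  exact key

/-- Induction step: the variance is the mean of the conditional variance given the coordinate `none`
plus the variance of the conditional mean `g`, and `g` is again Lipschitz. -/
theorem VarianceBound.option (h : VarianceBound ι) : VarianceBound (Option ι) := by
  intro f c hf
  set μ := stdGaussian ι
  set γ := gaussianReal 0 1
  let e := MeasurableEquiv.piOptionEquivProd (fun _ : Option ι => ℝ)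
  have hmp : MeasurePreserving e.symm (μ.prod γ) (stdGaussian (Option ι)) := by
    refine ⟨e.symm.measurable, ?_⟩
    exact Measure.pi_map_piOptionEquivProd (fun _ : Option ι => gaussianReal 0 1)
  let F : (ι → ℝ) × ℝ → ℝ := fun z => f (e.symm z)
  have hF : ∀ z w, |F z - F w| ≤ c none * |z.2 - w.2| + ∑ i, c (some i) * |z.1 i - w.1 i| := by
    intro z w
    refine (hf _ _).trans_eq ?_
    rw [Fintype.sum_option]
    rfl
  have hF2 : MemLp F 2 (μ.prod γ) := (memLp_of_coordinate_lipschitz hf).comp_measurePreserving hmp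
  have hFm : ∀ b, ∀ x y, |F (x, b) - F (y, b)| ≤ ∑ i, c (some i) * |x i - y i| := by
    intro b x y; simpa using hF (x, b) (y, b)
  let g : ℝ → ℝ := fun b => ∫ x, F (x, b) ∂μ
  have hFi : ∀ b, MemLp (fun x => F (x, b)) 2 μ := fun b => memLp_of_coordinate_lipschitz (hFm b)
  have hFint : ∀ b, Integrable (fun x => F (x, b)) μ := fun b => (hFi b).integrable (by norm_num)
  have hg : ∀ b b', |g b - g b'| ≤ c none * |b - b'| := by
    intro b b'
    simp only [g]
    rw [← integral_sub (hFint b) (hFint b')]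
    have h1 : ∀ x, |F (x, b) - F (x, b')| ≤ c none * |b - b'| := fun x => by
      simpa using hF (x, b) (x, b')
    simpa using norm_integral_le_of_norm_le_const (μ := μ) (f := fun x => F (x, b) - F (x, b'))
      (ae_of_all _ h1)
  have hgc : Continuous g := by
    refine continuous_iff_continuousAt.2 fun y => ?_
    rw [ContinuousAt, tendsto_iff_dist_tendsto_zero]
    refine squeeze_zero (fun _ => dist_nonneg) (fun x => (hg x y)) ?_
    have : Continuous fun x : ℝ => c none * |x - y| := by fun_prop
    simpa using this.tendsto y
  have hid : MemLp (fun x : ℝ => x) 2 γ := memLp_id_gaussianReal 2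
  have hgLp : MemLp g 2 γ := by
    have h : MemLp (fun x : ℝ => |g 0| + c none * |x|) 2 γ :=
      (memLp_const |g 0|).add (hid.norm.const_mul (c none))
    refine h.of_le hgc.aestronglyMeasurable (ae_of_all _ fun x => ?_)
    have h1 := hg x 0
    have h2 := abs_sub_abs_le_abs_sub (g x) (g 0)
    rw [sub_zero] at h1
    rw [Real.norm_eq_abs, Real.norm_eq_abs]
    refine le_trans ?_ (le_abs_self _)
    linarith
  have hFI : Integrable F (μ.prod γ) := hF2.integrable (by norm_num)
  set m := ∫ y, f y ∂stdGaussian (Option ι)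
  have hm1 : m = ∫ z, F z ∂μ.prod γ := (hmp.integral_comp' f).symm
  have hm2 : m = ∫ b, g b ∂γ := by rw [hm1, integral_prod_symm _ hFI]
  have hS : ∫ x, (f x - m) ^ 2 ∂stdGaussian (Option ι) = ∫ z, (F z - m) ^ 2 ∂μ.prod γ :=
    (hmp.integral_comp' (fun x => (f x - m) ^ 2)).symm
  have hI : Integrable (fun z => (F z - m) ^ 2) (μ.prod γ) :=
    (hF2.sub (memLp_const m)).integrable_sq
  -- The mean square deviation from `m`, conditionally on the coordinate `none`.
  have hsplit : ∀ b, ∫ x, (F (x, b) - m) ^ 2 ∂μ = ∫ x, (F (x, b) - g b) ^ 2 ∂μ + (g b - m) ^ 2 :=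
    fun b => integral_sub_const_sq (hFi b) m
  have h1 : ∫ b, (g b - m) ^ 2 ∂γ ≤ c none ^ 2 := by
    rw [hm2]
    have h0 := integral_sub_const_sq hgLp (g 0)
    refine (le_add_of_nonneg_right (sq_nonneg _)).trans (h0.symm.trans_le ?_)
    have hv : ∫ x : ℝ, x ^ 2 ∂γ = 1 := by
      have := variance_fun_id_gaussianReal (μ := 0) (v := 1)
      rw [variance_eq_integral (by fun_prop)] at this
      simpa using this
    calc ∫ b, (g b - g 0) ^ 2 ∂γ ≤ ∫ b, c none ^ 2 * b ^ 2 ∂γ := by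
          refine integral_mono (hgLp.sub (memLp_const _)).integrable_sq
            (hid.integrable_sq.const_mul _) fun b => ?_
          have := hg b 0
          rw [sub_zero] at this
          have h3 := pow_le_pow_left₀ (abs_nonneg _) this 2
          simpa [mul_pow] using h3
      _ = c none ^ 2 := by rw [integral_const_mul, hv, mul_one]
  rw [hS, integral_prod_symm _ hI, Fintype.sum_option]
  have hIb : Integrable (fun b => ∫ x, (F (x, b) - m) ^ 2 ∂μ) γ := hI.integral_prod_right
  have hIm : Integrable (fun b => (g b - m) ^ 2) γ := (hgLp.sub (memLp_const m)).integrable_sq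
  have hIg : Integrable (fun b => ∑ i, c (some i) ^ 2 + (g b - m) ^ 2) γ :=
    (integrable_const _).add hIm
  calc ∫ b, ∫ x, (F (x, b) - m) ^ 2 ∂μ ∂γ
      ≤ ∫ b, (∑ i, c (some i) ^ 2 + (g b - m) ^ 2) ∂γ := by
        refine integral_mono hIb hIg fun b => ?_
        simp only [hsplit]
        have := h (fun x => F (x, b)) (fun i => c (some i)) (hFm b)
        linarith
    _ = ∑ i, c (some i) ^ 2 + ∫ b, (g b - m) ^ 2 ∂γ := by
        rw [integral_add (integrable_const _) hIm]
        simp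
    _ ≤ _ := by linarith

/-- Efron-Stein bound: the variance of a function of independent standard Gaussians that is
`c i`-Lipschitz in the `i`-th of them is at most `∑ c i ^ 2`. -/
theorem integral_sub_integral_sq_le_of_coordinate_lipschitz {f : (ι → ℝ) → ℝ} {c : ι → ℝ}
    (hf : ∀ x y, |f x - f y| ≤ ∑ i, c i * |x i - y i|) :
    ∫ x, (f x - ∫ y, f y ∂stdGaussian ι) ^ 2 ∂stdGaussian ι ≤ ∑ i, c i ^ 2 := by
  suffices h : VarianceBound ι from h f c hf
  refine Fintype.induction_empty_option (P := fun α _ => VarianceBound α) ?_ ?_ ?_ ι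
  · intro α β _ e h
    let := Fintype.ofEquiv β e.symm
    have h' : VarianceBound α := by convert h
    exact h'.of_equiv e
  · intro f c _
    have h : ∀ x, f x = f 0 := fun x => congrArg f (Subsingleton.elim _ _)
    simp [h]
  · intro α _ h
    exact h.option

/-- The mean absolute deviation is at most the standard deviation. -/
theorem integral_abs_sub_integral_le_of_coordinate_lipschitz {f : (ι → ℝ) → ℝ} {c : ι → ℝ}
    (hf : ∀ x y, |f x - f y| ≤ ∑ i, c i * |x i - y i|) :
    ∫ x, |f x - ∫ y, f y ∂stdGaussian ι| ∂stdGaussian ι ≤ √(∑ i, c i ^ 2) := by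
  set m := ∫ y, f y ∂stdGaussian ι
  have h2 : MemLp (fun x => |f x - m|) 2 (stdGaussian ι) :=
    ((memLp_of_coordinate_lipschitz hf).sub (memLp_const m)).norm
  refine Real.le_sqrt_of_sq_le (le_trans ?_ (integral_sub_integral_sq_le_of_coordinate_lipschitz hf))
  have h := variance_nonneg (fun x => |f x - m|) (stdGaussian ι)
  rw [variance_eq_sub h2] at h
  simp only [Pi.pow_apply, sq_abs] at h
  linarith

/-! ### Gibbs averages of replicas -/

section Gibbs

variable {S : Type*} [Fintype S]

/-- The average of an observable of `n` independent replicas of the Gibbs measure on `S` with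
weights proportional to `exp (x σ)`. -/
noncomputable def gibbs {n : ℕ} (x : S → ℝ) (G : (Fin n → S) → ℝ) : ℝ :=
  (∑ σ : Fin n → S, G σ * Real.exp (∑ a, x (σ a))) / (∑ σ, Real.exp (x σ)) ^ n

/-- The free energy `log ∑ exp (x σ)`. -/
noncomputable def logPartition (x : S → ℝ) : ℝ := Real.log (∑ σ, Real.exp (x σ))

theorem sum_exp_pos [Nonempty S] (x : S → ℝ) : 0 < ∑ σ, Real.exp (x σ) :=
  Finset.sum_pos (fun _ _ => Real.exp_pos _) Finset.univ_nonempty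

variable {n k : ℕ}

theorem gibbs_add (x : S → ℝ) (G G' : (Fin n → S) → ℝ) :
    gibbs x (fun σ => G σ + G' σ) = gibbs x G + gibbs x G' := by
  simp only [gibbs, add_mul, Finset.sum_add_distrib, add_div]

theorem gibbs_sub (x : S → ℝ) (G G' : (Fin n → S) → ℝ) :
    gibbs x (fun σ => G σ - G' σ) = gibbs x G - gibbs x G' := by
  simp only [gibbs, sub_mul, Finset.sum_sub_distrib, sub_div]

theorem gibbs_const_mul (x : S → ℝ) (c : ℝ) (G : (Fin n → S) → ℝ) :
    gibbs x (fun σ => c * G σ) = c * gibbs x G := by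
  simp only [gibbs, mul_assoc, ← Finset.mul_sum, mul_div_assoc]

theorem gibbs_finsetSum {α : Type*} (s : Finset α) (x : S → ℝ) (G : α → (Fin n → S) → ℝ) :
    gibbs x (fun σ => ∑ i ∈ s, G i σ) = ∑ i ∈ s, gibbs x (G i) := by
  simp only [gibbs, Finset.sum_mul, ← Finset.sum_div]
  rw [Finset.sum_comm]

theorem gibbs_mono (x : S → ℝ) {G G' : (Fin n → S) → ℝ} (h : ∀ σ, G σ ≤ G' σ) :
    gibbs x G ≤ gibbs x G' := by
  unfold gibbs
  gcongr with σ
  exact h σ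

/-- A sum over the configurations of all replicas, of which a function of some of them is
summed, factorises. -/
theorem sum_comp_mul_prod_eq {κ ν : Type*} [Fintype κ] [Fintype ν] [DecidableEq κ] [DecidableEq ν]
    {e : κ → ν} (he : Function.Injective e) (w : S → ℝ) (G : (κ → S) → ℝ) :
    ∑ σ : ν → S, G (σ ∘ e) * ∏ a, w (σ a) =
      (∑ τ : κ → S, G τ * ∏ a, w (τ a)) * (∑ σ, w σ) ^ (Fintype.card ν - Fintype.card κ) := by
  classical
  let f : κ ⊕ {a : ν // a ∉ Set.range e} ≃ ν :=
    ((Equiv.ofInjective e he).sumCongr (Equiv.refl _)).trans (Equiv.Set.sumCompl (Set.range e))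
  have hf1 : ∀ a, f (Sum.inl a) = e a := fun a => rfl
  have hcard : Fintype.card ν - Fintype.card κ = Fintype.card {a : ν // a ∉ Set.range e} := by
    rw [← Fintype.card_congr f, Fintype.card_sum]; omega
  have hpow : (∑ σ, w σ) ^ Fintype.card {a : ν // a ∉ Set.range e} =
      ∑ ρ : {a : ν // a ∉ Set.range e} → S, ∏ a, w (ρ a) := by
    rw [← Finset.card_univ, ← Finset.prod_const, Finset.prod_univ_sum, Fintype.piFinset_univ]
  rw [hcard, hpow, Finset.sum_mul_sum, ← Fintype.sum_prod_type', ← (f.arrowCongr (Equiv.refl S)).sum_comp,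
    ← (Equiv.sumArrowEquivProdArrow κ {a : ν // a ∉ Set.range e} S).symm.sum_comp]
  refine Finset.sum_congr rfl fun z _ => ?_
  have h1 : (f.arrowCongr (Equiv.refl S)) ((Equiv.sumArrowEquivProdArrow κ _ S).symm z) ∘ e = z.1 := by
    funext a
    simp only [Function.comp_apply, Equiv.arrowCongr_apply, ← hf1, Equiv.symm_apply_apply]
    rfl
  rw [h1, ← f.prod_comp, Fintype.prod_sum_type]
  simp only [Equiv.arrowCongr_apply, Function.comp_apply, Equiv.symm_apply_apply, mul_assoc]
  rfl

/-- Replicas are exchangeable, and those on which an observable does not depend can be dropped. -/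
theorem gibbs_comp [Nonempty S] (x : S → ℝ) {e : Fin k → Fin n} (he : Function.Injective e)
    (G : (Fin k → S) → ℝ) : gibbs x (fun σ => G (σ ∘ e)) = gibbs x G := by
  have hkn : k ≤ n := by simpa using Fintype.card_le_of_injective e he
  have hZ := sum_exp_pos x
  unfold gibbs
  simp only [Real.exp_sum]
  rw [sum_comp_mul_prod_eq he (fun σ => Real.exp (x σ)) G, Fintype.card_fin, Fintype.card_fin,
    div_eq_div_iff (by positivity) (by positivity), mul_assoc, ← pow_add, Nat.sub_add_cancel hkn]

theorem gibbs_const [Nonempty S] (x : S → ℝ) (c : ℝ) : gibbs x (fun _ : Fin n → S => c) = c := by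
  have h := gibbs_comp (n := n) x (e := Fin.elim0) (fun a => a.elim0) (fun _ : Fin 0 → S => c)
  rw [h]
  simp [gibbs]

theorem abs_gibbs_le [Nonempty S] (x : S → ℝ) {G : (Fin n → S) → ℝ} {C : ℝ}
    (h : ∀ σ, |G σ| ≤ C) : |gibbs x G| ≤ C := by
  rw [abs_le]
  constructor
  · rw [← gibbs_const (n := n) x (-C)]
    exact gibbs_mono x fun σ => (abs_le.1 (h σ)).1
  · rw [← gibbs_const (n := n) x C]
    exact gibbs_mono x fun σ => (abs_le.1 (h σ)).2

theorem gibbs_one (x : S → ℝ) (y : S → ℝ) :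
    gibbs x (fun σ : Fin 1 → S => y (σ 0)) =
      (∑ σ, y σ * Real.exp (x σ)) / ∑ σ, Real.exp (x σ) := by
  unfold gibbs
  rw [pow_one, ← (Equiv.funUnique (Fin 1) S).symm.sum_comp]
  simp

/-- An additional replica is independent of the others. -/
theorem gibbs_init_mul_last (x : S → ℝ) (G : (Fin n → S) → ℝ) (y : S → ℝ) :
    gibbs x (fun σ : Fin (n + 1) → S => G (fun a => σ a.castSucc) * y (σ (Fin.last n))) =
      gibbs x G * gibbs x (fun σ : Fin 1 → S => y (σ 0)) := by
  rw [gibbs_one]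
  unfold gibbs
  rw [div_mul_div_comm, ← pow_succ]
  congr 1
  rw [← (Fin.snocEquiv (fun _ : Fin (n + 1) => S)).sum_comp, Fintype.sum_prod_type,
    Finset.sum_mul_sum, Finset.sum_comm]
  refine Finset.sum_congr rfl fun τ _ => Finset.sum_congr rfl fun s _ => ?_
  simp only [Fin.snocEquiv, Equiv.coe_fn_mk, Fin.snoc_castSucc, Fin.snoc_last, Fin.sum_univ_castSucc,
    Real.exp_add]
  ring

theorem continuous_gibbs [Nonempty S] (G : (Fin n → S) → ℝ) :
    Continuous fun x : S → ℝ => gibbs x G := by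
  unfold gibbs
  refine Continuous.div (by fun_prop) (by fun_prop) fun x => (pow_pos (sum_exp_pos x) n).ne'

theorem continuous_logPartition [Nonempty S] : Continuous (logPartition : (S → ℝ) → ℝ) := by
  unfold logPartition
  exact Continuous.log (by fun_prop) fun x => (sum_exp_pos x).ne'

/-- The response of a Gibbs average to a perturbation of the weights brings in one more
replica. -/
theorem hasDerivAt_gibbs [Nonempty S] {x : ℝ → S → ℝ} {y : S → ℝ} {t : ℝ}
    (hx : ∀ σ, HasDerivAt (fun u => x u σ) (y σ) t) (G : (Fin n → S) → ℝ) :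
    HasDerivAt (fun u => gibbs (x u) G)
      (gibbs (x t) fun σ : Fin (n + 1) → S => G (fun a => σ a.castSucc) *
        (∑ b : Fin n, y (σ b.castSucc) - n * y (σ (Fin.last n)))) t := by
  have hZ := sum_exp_pos (x t)
  have h1 : HasDerivAt (fun u => ∑ σ : Fin n → S, G σ * Real.exp (∑ a, x u (σ a)))
      (∑ σ : Fin n → S, G σ * (Real.exp (∑ a, x t (σ a)) * ∑ a, y (σ a))) t :=
    HasDerivAt.fun_sum fun σ _ =>
      ((HasDerivAt.fun_sum fun a _ => hx (σ a)).exp).const_mul _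
  have h2 : HasDerivAt (fun u => (∑ σ, Real.exp (x u σ)) ^ n)
      (n * (∑ σ, Real.exp (x t σ)) ^ (n - 1) * ∑ σ, Real.exp (x t σ) * y σ) t :=
    (HasDerivAt.fun_sum fun σ _ => (hx σ).exp).fun_pow n
  have h3 := h1.fun_div h2 (pow_pos hZ n).ne'
  refine h3.congr_deriv ?_
  simp only [mul_sub, ← mul_assoc]
  have e1 : gibbs (x t) (fun σ : Fin (n + 1) → S => G (fun a => σ a.castSucc) *
      ∑ b : Fin n, y (σ b.castSucc)) = gibbs (x t) (fun σ => G σ * ∑ b, y (σ b)) :=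
    gibbs_comp (x t) (Fin.castSucc_injective n) (fun σ => G σ * ∑ b, y (σ b))
  have e2 := gibbs_init_mul_last (x t) (fun σ => G σ * n) y
  rw [gibbs_sub, e1, e2, gibbs_one]
  simp only [mul_comm _ (n : ℝ)]
  rw [gibbs_const_mul]
  unfold gibbs
  have e3 : ∀ σ : Fin n → S, G σ * Real.exp (∑ a, x t (σ a)) * ∑ a, y (σ a) =
      G σ * (∑ a, y (σ a)) * Real.exp (∑ a, x t (σ a)) := fun σ => by ring
  simp only [e3, mul_comm (Real.exp _) (y _)]
  set A := ∑ σ : Fin n → S, G σ * (∑ a, y (σ a)) * Real.exp (∑ a, x t (σ a))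
  set B := ∑ σ : Fin n → S, G σ * Real.exp (∑ a, x t (σ a))
  set Z := ∑ σ, Real.exp (x t σ)
  set Y := ∑ σ, y σ * Real.exp (x t σ)
  rcases Nat.eq_zero_or_pos n with hn | hn
  · subst hn; simp
  · obtain ⟨l, rfl⟩ : ∃ l, n = l + 1 := ⟨n - 1, by omega⟩
    simp only [Nat.add_sub_cancel]
    field_simp
    ring

theorem hasDerivAt_logPartition [Nonempty S] {x : ℝ → S → ℝ} {y : S → ℝ} {t : ℝ}
    (hx : ∀ σ, HasDerivAt (fun u => x u σ) (y σ) t) :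
    HasDerivAt (fun u => logPartition (x u)) (gibbs (x t) fun σ : Fin 1 → S => y (σ 0)) t := by
  have hZ := sum_exp_pos (x t)
  have h := (HasDerivAt.fun_sum (u := Finset.univ) fun σ _ => (hx σ).exp).log hZ.ne'
  refine h.congr_deriv ?_
  rw [gibbs_one]
  simp only [mul_comm]

/-- Gibbs variational principle: tilting the Gibbs measure by a density bounded by `C` times its
mean costs at most `log C` in relative entropy. -/
theorem gibbs_mul_le [Nonempty S] (x y : S → ℝ) {G : (Fin n → S) → ℝ} {C : ℝ}
    (h1 : ∀ σ, 1 ≤ G σ) (hC : ∀ σ, G σ ≤ C) (a : Fin n) :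
    gibbs x (fun σ => G σ * y (σ a)) ≤
      gibbs x G * (Real.log C + (logPartition (fun σ => x σ + y σ) - logPartition x)) := by
  have hg : 1 ≤ gibbs x G := by
    rw [← gibbs_const (n := n) x 1]; exact gibbs_mono x h1
  have hC1 : 1 ≤ C := by
    have := gibbs_mono x hC
    rw [gibbs_const] at this; linarith
  set g := gibbs x G
  set m := gibbs x (fun σ => G σ * y (σ a)) / g with hm
  have hmg : gibbs x (fun σ => G σ * y (σ a)) = g * m := by
    rw [hm]; field_simp
  rw [hmg]
  refine mul_le_mul_of_nonneg_left ?_ (by linarith)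
  have hZ := sum_exp_pos x
  have hZ' := sum_exp_pos fun σ => x σ + y σ
  have hE : gibbs x (fun σ : Fin n → S => Real.exp (y (σ a))) =
      (∑ σ, Real.exp (x σ + y σ)) / ∑ σ, Real.exp (x σ) := by
    have h := gibbs_comp x (e := fun _ : Fin 1 => a) (fun i j _ => Subsingleton.elim i j)
      (fun σ => Real.exp (y (σ 0)))
    rw [gibbs_one x (fun s => Real.exp (y s))] at h
    refine h.trans ?_
    simp only [mul_comm (Real.exp (y _)), ← Real.exp_add]
  -- Jensen's inequality under the tilted measure, from the tangent line of `exp` at the mean.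
  have hJ : g * Real.exp m ≤ C * gibbs x (fun σ : Fin n → S => Real.exp (y (σ a))) := by
    have e1 : gibbs x (fun σ => Real.exp m * (1 - m) * G σ + Real.exp m * (G σ * y (σ a))) =
        g * Real.exp m := by
      rw [gibbs_add, gibbs_const_mul, gibbs_const_mul, hmg]; ring
    rw [← e1, ← gibbs_const_mul]
    refine gibbs_mono x fun σ => ?_
    have t1 : Real.exp m * (1 + (y (σ a) - m)) ≤ Real.exp (y (σ a)) := by
      have := Real.add_one_le_exp (y (σ a) - m)
      calc Real.exp m * (1 + (y (σ a) - m)) ≤ Real.exp m * Real.exp (y (σ a) - m) := by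
            gcongr; linarith
        _ = Real.exp (y (σ a)) := by rw [← Real.exp_add]; congr 1; ring
    calc Real.exp m * (1 - m) * G σ + Real.exp m * (G σ * y (σ a))
        = G σ * (Real.exp m * (1 + (y (σ a) - m))) := by ring
      _ ≤ G σ * Real.exp (y (σ a)) :=
          mul_le_mul_of_nonneg_left t1 (by linarith [h1 σ])
      _ ≤ C * Real.exp (y (σ a)) := mul_le_mul_of_nonneg_right (hC σ) (Real.exp_pos _).le
  have h2 : Real.exp m ≤ C * ((∑ σ, Real.exp (x σ + y σ)) / ∑ σ, Real.exp (x σ)) := by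
    rw [← hE]
    refine le_trans ?_ hJ
    exact le_mul_of_one_le_left (Real.exp_pos m).le hg
  have h3 := Real.log_le_log (Real.exp_pos m) h2
  rw [Real.log_exp, Real.log_mul (zero_lt_one.trans_le hC1).ne' (div_pos hZ' hZ).ne',
    Real.log_div hZ'.ne' hZ.ne'] at h3
  exact h3

/-- The Gibbs average of the perturbation is a subgradient of the free energy. -/
theorem gibbs_le_logPartition_sub [Nonempty S] (x y : S → ℝ) :
    gibbs x (fun σ : Fin 1 → S => y (σ 0)) ≤
      logPartition (fun σ => x σ + y σ) - logPartition x := by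
  have h := gibbs_mul_le x y (G := fun _ : Fin 1 → S => 1) (C := 1) (fun _ => le_rfl)
    (fun _ => le_rfl) 0
  simpa [gibbs_const] using h

theorem logPartition_sub_le [Nonempty S] {x y : S → ℝ} {d : ℝ} (h : ∀ σ, x σ - y σ ≤ d) :
    logPartition x - logPartition y ≤ d := by
  have h1 := gibbs_le_logPartition_sub x (fun σ => y σ - x σ)
  have h2 : -d ≤ gibbs x (fun σ : Fin 1 → S => y (σ 0) - x (σ 0)) := by
    rw [← gibbs_const (n := 1) x (-d)]
    exact gibbs_mono x fun σ => by linarith [h (σ 0)]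
  have h3 : (fun σ => x σ + (y σ - x σ)) = y := funext fun σ => by ring
  rw [h3] at h1
  linarith

theorem abs_logPartition_sub_le [Nonempty S] {x y : S → ℝ} {d : ℝ} (h : ∀ σ, |x σ - y σ| ≤ d) :
    |logPartition x - logPartition y| ≤ d := by
  rw [abs_le]
  have h1 := logPartition_sub_le fun σ => (le_abs_self _).trans (h σ)
  have h2 := logPartition_sub_le fun σ => (le_abs_self _).trans ((abs_sub_comm _ _).trans_le (h σ))
  constructor <;> linarith

end Gibbs

/-! ### Gibbs averages and free energies of Gaussian fields -/

section Field

variable {S ι κ : Type*} [Fintype ι] [Fintype κ]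

/-- The Gaussian field `σ ↦ ∑ J i * v i σ` with couplings `J`. -/
def field (v : ι → S → ℝ) (J : ι → ℝ) (σ : S) : ℝ := ∑ i, J i * v i σ

/-- The covariance of the fields with coefficients `u` and `v` and the same couplings. -/
def crossCov (u v : ι → S → ℝ) (σ τ : S) : ℝ := ∑ i, u i σ * v i τ

theorem continuous_field (v : ι → S → ℝ) : Continuous (field v) := by
  unfold field
  fun_prop

theorem field_update [DecidableEq ι] (v : ι → S → ℝ) (J : ι → ℝ) (i : ι) (y : ℝ) (σ : S) :
    field v (Function.update J i y) σ = field v J σ + (y - J i) * v i σ := by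
  unfold field
  rw [← Finset.add_sum_erase _ _ (Finset.mem_univ i),
    ← Finset.add_sum_erase _ (fun j => J j * v j σ) (Finset.mem_univ i), Function.update_self]
  have : ∑ j ∈ Finset.univ.erase i, Function.update J i y j * v j σ =
      ∑ j ∈ Finset.univ.erase i, J j * v j σ :=
    Finset.sum_congr rfl fun j hj => by rw [Function.update_of_ne (Finset.ne_of_mem_erase hj)]
  rw [this]
  ring

theorem abs_field_sub_le {v : ι → S → ℝ} {c : ι → ℝ} (hc : ∀ i σ, |v i σ| ≤ c i) (J J' : ι → ℝ)
    (σ : S) : |field v J σ - field v J' σ| ≤ ∑ i, c i * |J i - J' i| := by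
  unfold field
  rw [← Finset.sum_sub_distrib]
  refine (Finset.abs_sum_le_sum_abs _ _).trans (Finset.sum_le_sum fun i _ => ?_)
  rw [← sub_mul, abs_mul, mul_comm]
  exact mul_le_mul_of_nonneg_right (hc i σ) (abs_nonneg _)

/-- Coefficients of the field `sin θ X + cos θ Y`, where `X` and `Y` are independent fields with
coefficients `v` and `w`. -/
noncomputable def interpolation (v : ι → S → ℝ) (w : κ → S → ℝ) (θ : ℝ) : ι ⊕ κ → S → ℝ :=
  Sum.elim (fun i σ => Real.sin θ * v i σ) (fun k σ => Real.cos θ * w k σ)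

/-- Coefficients of `cos θ X - sin θ Y`. -/
noncomputable def interpolationDeriv (v : ι → S → ℝ) (w : κ → S → ℝ) (θ : ℝ) : ι ⊕ κ → S → ℝ :=
  Sum.elim (fun i σ => Real.cos θ * v i σ) (fun k σ => -Real.sin θ * w k σ)

theorem crossCov_interpolation (v : ι → S → ℝ) (w : κ → S → ℝ) (θ : ℝ) (σ τ : S) :
    crossCov (interpolationDeriv v w θ) (interpolation v w θ) σ τ =
      Real.sin θ * Real.cos θ * (crossCov v v σ τ - crossCov w w σ τ) := by
  simp only [crossCov, interpolation, interpolationDeriv, Fintype.sum_sum_type, Sum.elim_inl,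
    Sum.elim_inr, mul_sub, Finset.mul_sum]
  rw [sub_eq_add_neg, ← Finset.sum_neg_distrib]
  congr 1 <;> exact Finset.sum_congr rfl fun i _ => by ring

theorem hasDerivAt_field_interpolation (v : ι → S → ℝ) (w : κ → S → ℝ) (θ : ℝ) (J : ι ⊕ κ → ℝ)
    (σ : S) : HasDerivAt (fun t => field (interpolation v w t) J σ)
      (field (interpolationDeriv v w θ) J σ) θ := by
  unfold field
  refine HasDerivAt.fun_sum fun i _ => HasDerivAt.const_mul _ ?_
  rcases i with i | k
  · exact (Real.hasDerivAt_sin θ).mul_const _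
  · exact (Real.hasDerivAt_cos θ).mul_const _

variable [Fintype S] {n : ℕ}

/-- The quenched free energy `𝔼 log ∑ exp (∑ J i * v i σ)`. -/
noncomputable def freeEnergy (v : ι → S → ℝ) : ℝ :=
  ∫ J, logPartition (field v J) ∂stdGaussian ι

theorem exists_abs_le {T : Type*} [Fintype T] (G : T → ℝ) : ∃ C, 0 ≤ C ∧ ∀ σ, |G σ| ≤ C :=
  ⟨∑ τ, |G τ|, Finset.sum_nonneg fun _ _ => abs_nonneg _, fun σ =>
    Finset.single_le_sum (f := fun τ => |G τ|) (fun _ _ => abs_nonneg _) (Finset.mem_univ σ)⟩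

theorem continuous_gibbs_field [Nonempty S] (v : ι → S → ℝ) (G : (Fin n → S) → ℝ) :
    Continuous fun J => gibbs (field v J) G :=
  (continuous_gibbs G).comp (continuous_field v)

theorem integrable_gibbs_field [Nonempty S] (v : ι → S → ℝ) (G : (Fin n → S) → ℝ) :
    Integrable (fun J => gibbs (field v J) G) (stdGaussian ι) := by
  obtain ⟨C, -, hC⟩ := exists_abs_le G
  exact Integrable.of_bound (continuous_gibbs_field v G).aestronglyMeasurable C
    (ae_of_all _ fun J => abs_gibbs_le _ hC)

/-- Gaussian integration by parts for one coupling in a Gibbs average. -/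
theorem integral_eval_mul_gibbs [Nonempty S] (v : ι → S → ℝ) (i : ι) (G : (Fin n → S) → ℝ) :
    ∫ J, J i * gibbs (field v J) G ∂stdGaussian ι =
      ∫ J, gibbs (field v J) (fun σ : Fin (n + 1) → S => G (fun a => σ a.castSucc) *
        (∑ b : Fin n, v i (σ b.castSucc) - n * v i (σ (Fin.last n)))) ∂stdGaussian ι := by
  classical
  obtain ⟨C, -, hC⟩ := exists_abs_le G
  obtain ⟨C', -, hC'⟩ := exists_abs_le (fun σ : Fin (n + 1) → S => G (fun a => σ a.castSucc) *
        (∑ b : Fin n, v i (σ b.castSucc) - n * v i (σ (Fin.last n))))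
  refine integral_eval_mul_stdGaussian i (C := max C C') (fun J x => ?_)
    (continuous_gibbs_field v _) (continuous_gibbs_field v _)
    (fun J => (abs_gibbs_le _ hC).trans (le_max_left _ _))
    (fun J => (abs_gibbs_le _ hC').trans (le_max_right _ _))
  refine hasDerivAt_gibbs (x := fun y => field v (Function.update J i y)) (fun σ => ?_) G
  simp only [field_update]
  simpa using (((hasDerivAt_id x).sub_const (J i)).mul_const (v i σ)).const_add (field v J σ)

theorem gibbs_mul_field (x : S → ℝ) (u : ι → S → ℝ) (J : ι → ℝ) (F : (Fin n → S) → ℝ)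
    (a : Fin n) : gibbs x (fun σ => F σ * field u J (σ a)) =
      ∑ i, J i * gibbs x (fun σ => F σ * u i (σ a)) := by
  simp only [← gibbs_const_mul]
  rw [← gibbs_finsetSum]
  congr 1
  funext σ
  rw [field, Finset.mul_sum]
  exact Finset.sum_congr rfl fun i _ => by ring

theorem integrable_eval_mul_gibbs [Nonempty S] (v : ι → S → ℝ) (i : ι) (G : (Fin n → S) → ℝ) :
    Integrable (fun J => J i * gibbs (field v J) G) (stdGaussian ι) := by
  obtain ⟨C, -, hC⟩ := exists_abs_le G
  exact (integrable_eval_stdGaussian i).mul_bdd (c := C)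
    (continuous_gibbs_field v _).aestronglyMeasurable (ae_of_all _ fun J => abs_gibbs_le _ hC)

theorem integrable_gibbs_mul_field [Nonempty S] (u v : ι → S → ℝ) (F : (Fin n → S) → ℝ)
    (a : Fin n) :
    Integrable (fun J => gibbs (field v J) (fun σ => F σ * field u J (σ a))) (stdGaussian ι) := by
  simp only [gibbs_mul_field]
  exact integrable_finsetSum _ fun i _ => integrable_eval_mul_gibbs v i _

theorem integrable_gibbs_field_self [Nonempty S] (u v : ι → S → ℝ) :
    Integrable (fun J => gibbs (field v J) (fun σ : Fin 1 → S => field u J (σ 0)))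
      (stdGaussian ι) := by
  simpa using integrable_gibbs_mul_field u v (fun _ : Fin 1 → S => 1) 0

/-- Gaussian integration by parts for a field in a Gibbs average: the field at replica `a`
contracts with the fields of all replicas and of one additional replica. -/
theorem integral_gibbs_mul_field [Nonempty S] (u v : ι → S → ℝ) (F : (Fin n → S) → ℝ)
    (a : Fin n) :
    ∫ J, gibbs (field v J) (fun σ => F σ * field u J (σ a)) ∂stdGaussian ι =
      ∫ J, gibbs (field v J) (fun σ : Fin (n + 1) → S => F (fun b => σ b.castSucc) *
        (∑ b : Fin n, crossCov u v (σ a.castSucc) (σ b.castSucc) -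
          n * crossCov u v (σ a.castSucc) (σ (Fin.last n)))) ∂stdGaussian ι := by
  have h2 : ∀ J : ι → ℝ, gibbs (field v J) (fun σ : Fin (n + 1) → S => F (fun b => σ b.castSucc) *
        (∑ b : Fin n, crossCov u v (σ a.castSucc) (σ b.castSucc) -
          n * crossCov u v (σ a.castSucc) (σ (Fin.last n)))) =
      ∑ i, gibbs (field v J) (fun σ : Fin (n + 1) → S =>
        F (fun b => σ b.castSucc) * u i (σ a.castSucc) *
        (∑ b : Fin n, v i (σ b.castSucc) - n * v i (σ (Fin.last n)))) := by
    intro J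
    rw [← gibbs_finsetSum]
    congr 1
    funext σ
    simp only [crossCov]
    rw [Finset.sum_comm, Finset.mul_sum, ← Finset.sum_sub_distrib, Finset.mul_sum]
    refine Finset.sum_congr rfl fun i _ => ?_
    rw [← Finset.mul_sum]
    ring
  simp only [gibbs_mul_field, h2]
  rw [integral_finsetSum _ fun i _ => integrable_eval_mul_gibbs v i _,
    integral_finsetSum _ fun i _ => integrable_gibbs_field v _]
  exact Finset.sum_congr rfl fun i _ => integral_eval_mul_gibbs v i (fun σ => F σ * u i (σ a))

/-- Integration by parts for the mean of a field. -/
theorem integral_gibbs_field [Nonempty S] (u v : ι → S → ℝ) :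
    ∫ J, gibbs (field v J) (fun σ : Fin 1 → S => field u J (σ 0)) ∂stdGaussian ι =
      ∫ J, gibbs (field v J) (fun σ : Fin 2 → S =>
        crossCov u v (σ 0) (σ 0) - crossCov u v (σ 0) (σ 1)) ∂stdGaussian ι := by
  have h := integral_gibbs_mul_field u v (fun _ : Fin 1 → S => 1) 0
  simpa using h

theorem abs_logPartition_field_sub_le [Nonempty S] {v : ι → S → ℝ} {c : ι → ℝ}
    (hc : ∀ i σ, |v i σ| ≤ c i) (J J' : ι → ℝ) :
    |logPartition (field v J) - logPartition (field v J')| ≤ ∑ i, c i * |J i - J' i| :=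
  abs_logPartition_sub_le fun σ => abs_field_sub_le hc J J' σ

theorem continuous_logPartition_field [Nonempty S] (v : ι → S → ℝ) :
    Continuous fun J => logPartition (field v J) :=
  continuous_logPartition.comp (continuous_field v)

theorem integrable_logPartition_field [Nonempty S] (v : ι → S → ℝ) :
    Integrable (fun J => logPartition (field v J)) (stdGaussian ι) := by
  choose c _ hc using fun i => exists_abs_le (v i)
  exact (memLp_of_coordinate_lipschitz (abs_logPartition_field_sub_le hc)).integrable
    (by norm_num)

/-- Concentration of the free energy. -/
theorem integral_abs_logPartition_sub_le [Nonempty S] {v : ι → S → ℝ} {c : ι → ℝ}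
    (hc : ∀ i σ, |v i σ| ≤ c i) :
    ∫ J, |logPartition (field v J) - freeEnergy v| ∂stdGaussian ι ≤ √(∑ i, c i ^ 2) :=
  integral_abs_sub_integral_le_of_coordinate_lipschitz (abs_logPartition_field_sub_le hc)

theorem integral_comp_inl {f : (ι → ℝ) → ℝ} (hf : Continuous f) :
    ∫ J, f (fun i => J (Sum.inl i)) ∂stdGaussian (ι ⊕ κ) = ∫ J, f J ∂stdGaussian ι := by
  have h : MeasurePreserving (fun J : ι ⊕ κ → ℝ => fun i => J (Sum.inl i))
      (stdGaussian (ι ⊕ κ)) (stdGaussian ι) :=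
    measurePreserving_fst.comp
      (measurePreserving_sumPiEquivProdPi (fun _ : ι ⊕ κ => gaussianReal 0 1))
  rw [← h.map_eq, integral_map h.measurable.aemeasurable hf.aestronglyMeasurable]

theorem integral_comp_inr {f : (κ → ℝ) → ℝ} (hf : Continuous f) :
    ∫ J, f (fun i => J (Sum.inr i)) ∂stdGaussian (ι ⊕ κ) = ∫ J, f J ∂stdGaussian κ := by
  have h : MeasurePreserving (fun J : ι ⊕ κ → ℝ => fun i => J (Sum.inr i))
      (stdGaussian (ι ⊕ κ)) (stdGaussian κ) :=
    measurePreserving_snd.comp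
      (measurePreserving_sumPiEquivProdPi (fun _ : ι ⊕ κ => gaussianReal 0 1))
  rw [← h.map_eq, integral_map h.measurable.aemeasurable hf.aestronglyMeasurable]

/-- The derivative along the interpolation, after integration by parts. -/
theorem hasDerivAt_freeEnergy_interpolation [Nonempty S] (v : ι → S → ℝ) (w : κ → S → ℝ) (θ : ℝ) :
    HasDerivAt (fun t => freeEnergy (interpolation v w t))
      (∫ J, gibbs (field (interpolation v w θ) J) (fun σ : Fin 2 → S =>
        crossCov (interpolationDeriv v w θ) (interpolation v w θ) (σ 0) (σ 0) -
        crossCov (interpolationDeriv v w θ) (interpolation v w θ) (σ 0) (σ 1))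
        ∂stdGaussian (ι ⊕ κ)) θ := by
  rw [← integral_gibbs_field]
  choose c hc0 hc using fun i => exists_abs_le (v i)
  choose d hd0 hd using fun i => exists_abs_le (w i)
  have hb : ∀ t i σ, |interpolationDeriv v w t i σ| ≤ Sum.elim c d i := by
    intro t i σ
    rcases i with i | k
    · simp only [interpolationDeriv, Sum.elim_inl, abs_mul]
      exact (mul_le_of_le_one_left (abs_nonneg _) (Real.abs_cos_le_one t)).trans (hc i σ)
    · simp only [interpolationDeriv, Sum.elim_inr, abs_mul, abs_neg]
      exact (mul_le_of_le_one_left (abs_nonneg _) (Real.abs_sin_le_one t)).trans (hd k σ)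
  unfold freeEnergy
  refine (hasDerivAt_integral_of_dominated_loc_of_deriv_le (s := Set.univ)
    (F' := fun t J => gibbs (field (interpolation v w t) J) (fun σ : Fin 1 → S =>
      field (interpolationDeriv v w t) J (σ 0)))
    (bound := fun J => ∑ i, Sum.elim c d i * |J i|) univ_mem
    (Eventually.of_forall fun t => (integrable_logPartition_field _).aestronglyMeasurable)
    (integrable_logPartition_field _) ?_ (ae_of_all _ fun J t _ => ?_) ?_
    (ae_of_all _ fun J t _ => ?_)).2
  · exact (integrable_gibbs_field_self _ _).aestronglyMeasurable
  · refine abs_gibbs_le _ fun σ => ?_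
    have h0 : field (interpolationDeriv v w t) 0 (σ 0) = 0 := by simp [field]
    simpa [h0] using abs_field_sub_le (hb t) J 0 (σ 0)
  · exact integrable_finsetSum _ fun i _ => (integrable_eval_stdGaussian i).abs.const_mul _
  · exact hasDerivAt_logPartition fun σ => hasDerivAt_field_interpolation v w t J σ

/-- Comparison of quenched free energies: the free energy increases with the variances of the
field and decreases with the covariances between different configurations. -/
theorem freeEnergy_le_of_cov_le [Nonempty S] (v : ι → S → ℝ) (w : κ → S → ℝ) {d : ℝ}
    (h : ∀ σ τ, (crossCov w w σ σ - crossCov w w σ τ) - (crossCov v v σ σ - crossCov v v σ τ) ≤ d) :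
    freeEnergy w ≤ freeEnergy v + d / 2 := by
  -- The derivative of the interpolated free energy is at least `-d sin θ cos θ`, which the second
  -- term compensates.
  let φ : ℝ → ℝ := fun θ => freeEnergy (interpolation v w θ) + d / 2 * Real.sin θ ^ 2
  have hφ : ∀ θ, HasDerivAt φ ((∫ J, gibbs (field (interpolation v w θ) J) (fun σ : Fin 2 → S =>
        crossCov (interpolationDeriv v w θ) (interpolation v w θ) (σ 0) (σ 0) -
        crossCov (interpolationDeriv v w θ) (interpolation v w θ) (σ 0) (σ 1))
        ∂stdGaussian (ι ⊕ κ)) + d * (Real.sin θ * Real.cos θ)) θ := by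
    intro θ
    refine (hasDerivAt_freeEnergy_interpolation v w θ).add ?_
    refine (((Real.hasDerivAt_sin θ).fun_pow 2).const_mul (d / 2)).congr_deriv ?_
    simp
    ring
  have hmono : MonotoneOn φ (Set.Icc 0 (Real.pi / 2)) := by
    refine monotoneOn_of_deriv_nonneg (convex_Icc _ _)
      (fun θ _ => (hφ θ).continuousAt.continuousWithinAt)
      (fun θ _ => (hφ θ).differentiableAt.differentiableWithinAt) fun θ hθ => ?_
    rw [interior_Icc] at hθ
    rw [(hφ θ).deriv]
    have hs : 0 ≤ Real.sin θ * Real.cos θ :=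
      mul_nonneg (Real.sin_nonneg_of_nonneg_of_le_pi hθ.1.le (by linarith [hθ.2, Real.pi_pos]))
        (Real.cos_nonneg_of_neg_pi_div_two_le_of_le (by linarith [hθ.1, Real.pi_pos]) hθ.2.le)
    have : -(d * (Real.sin θ * Real.cos θ)) ≤ ∫ J, gibbs (field (interpolation v w θ) J)
        (fun σ : Fin 2 → S =>
        crossCov (interpolationDeriv v w θ) (interpolation v w θ) (σ 0) (σ 0) -
        crossCov (interpolationDeriv v w θ) (interpolation v w θ) (σ 0) (σ 1))
        ∂stdGaussian (ι ⊕ κ) := by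
      have hc : ∫ _ : ι ⊕ κ → ℝ, -(d * (Real.sin θ * Real.cos θ)) ∂stdGaussian (ι ⊕ κ) =
        -(d * (Real.sin θ * Real.cos θ)) := by simp
      rw [← hc]
      refine integral_mono (integrable_const _) (integrable_gibbs_field _ _) fun J => ?_
      rw [← gibbs_const (n := 2) (field (interpolation v w θ) J) (-(d * (Real.sin θ * Real.cos θ)))]
      refine gibbs_mono _ fun σ => ?_
      rw [crossCov_interpolation, crossCov_interpolation]
      nlinarith [mul_le_mul_of_nonneg_left (h (σ 0) (σ 1)) hs]
    linarith
  have h01 := hmono (Set.left_mem_Icc.2 (by positivity)) (Set.right_mem_Icc.2 (by positivity))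
    (by positivity : (0 : ℝ) ≤ Real.pi / 2)
  have e0 : freeEnergy (interpolation v w 0) = freeEnergy w := by
    unfold freeEnergy
    rw [← integral_comp_inr (ι := ι) (continuous_logPartition_field w)]
    refine integral_congr_ae (ae_of_all _ fun J => congrArg logPartition (funext fun σ => ?_))
    simp [field, interpolation]
  have e1 : freeEnergy (interpolation v w (Real.pi / 2)) = freeEnergy v := by
    unfold freeEnergy
    rw [← integral_comp_inl (κ := κ) (continuous_logPartition_field v)]
    refine integral_congr_ae (ae_of_all _ fun J => congrArg logPartition (funext fun σ => ?_))
    simp [field, interpolation]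
  simp only [φ, e0, e1, Real.sin_zero, Real.sin_pi_div_two] at h01
  linarith

/-- The free energy of two independent non-interacting systems is the sum of theirs. -/
theorem freeEnergy_prod {S₁ S₂ : Type*} [Fintype S₁] [Fintype S₂] [Nonempty S₁] [Nonempty S₂]
    (e : S ≃ S₁ × S₂) (v : ι → S₁ → ℝ) (w : κ → S₂ → ℝ) :
    freeEnergy (Sum.elim (fun i σ => v i (e σ).1) (fun k σ => w k (e σ).2)) =
      freeEnergy v + freeEnergy w := by
  have h : ∀ J : ι ⊕ κ → ℝ,
      logPartition (field (Sum.elim (fun i σ => v i (e σ).1) (fun k σ => w k (e σ).2)) J) =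
      logPartition (field v fun i => J (Sum.inl i)) +
        logPartition (field w fun k => J (Sum.inr k)) := by
    intro J
    unfold logPartition
    rw [← Real.log_mul (sum_exp_pos _).ne' (sum_exp_pos _).ne', Finset.sum_mul_sum,
      ← Fintype.sum_prod_type', ← e.sum_comp]
    congr 1
    refine Finset.sum_congr rfl fun σ _ => ?_
    rw [← Real.exp_add]
    simp [field]
  have iv : Integrable (fun J : ι ⊕ κ → ℝ => logPartition (field v fun i => J (Sum.inl i)))
      (stdGaussian (ι ⊕ κ)) :=
    (measurePreserving_fst.comp (measurePreserving_sumPiEquivProdPi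
      (fun _ : ι ⊕ κ => gaussianReal 0 1))).integrable_comp_of_integrable
        (integrable_logPartition_field v)
  have iw : Integrable (fun J : ι ⊕ κ → ℝ => logPartition (field w fun i => J (Sum.inr i)))
      (stdGaussian (ι ⊕ κ)) :=
    (measurePreserving_snd.comp (measurePreserving_sumPiEquivProdPi
      (fun _ : ι ⊕ κ => gaussianReal 0 1))).integrable_comp_of_integrable
        (integrable_logPartition_field w)
  unfold freeEnergy
  simp only [h]
  rw [integral_add iv iw, integral_comp_inl (continuous_logPartition_field v),
    integral_comp_inr (continuous_logPartition_field w)]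

end Field

/-! ### Powers of sums and elementary symmetric polynomials -/

section Combinatorics

/-- The elementary symmetric polynomial of degree `p` in the variables `x i`. -/
def elemSymm {N : ℕ} (p : ℕ) (x : Fin N → ℝ) : ℝ :=
  ∑ A ∈ Finset.univ.powersetCard p, ∏ i ∈ A, x i

/-- Multiplying by one more variable either extends the monomial or repeats a variable. -/
theorem sum_mul_elemSymm {N : ℕ} (p : ℕ) (x : Fin N → ℝ) :
    (∑ i, x i) * elemSymm p x = (p + 1) * elemSymm (p + 1) x +
      ∑ A ∈ Finset.univ.powersetCard p, ∑ i ∈ A, x i * ∏ j ∈ A, x j := by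
  have h1 : (∑ i, x i) * elemSymm p x =
      ∑ A ∈ Finset.univ.powersetCard p, ∑ i ∈ Aᶜ, x i * ∏ j ∈ A, x j +
      ∑ A ∈ Finset.univ.powersetCard p, ∑ i ∈ A, x i * ∏ j ∈ A, x j := by
    rw [elemSymm, Finset.mul_sum, ← Finset.sum_add_distrib]
    refine Finset.sum_congr rfl fun A _ => ?_
    rw [Finset.sum_compl_add_sum, Finset.sum_mul]
  have h2 : (p + 1) * elemSymm (p + 1) x =
      ∑ B ∈ Finset.univ.powersetCard (p + 1), ∑ i ∈ B, ∏ j ∈ B, x j := by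
    rw [elemSymm, Finset.mul_sum]
    refine Finset.sum_congr rfl fun B hB => ?_
    rw [Finset.sum_const, (Finset.mem_powersetCard.1 hB).2]
    simp
  rw [h1, h2]
  congr 1
  rw [Finset.sum_sigma', Finset.sum_sigma']
  refine Finset.sum_bij' (fun z _ => ⟨insert z.2 z.1, z.2⟩) (fun z _ => ⟨z.1.erase z.2, z.2⟩)
    ?_ ?_ ?_ ?_ ?_
  · rintro ⟨A, i⟩ h
    simp only [Finset.mem_sigma, Finset.mem_powersetCard, Finset.mem_compl] at h ⊢
    refine ⟨⟨Finset.subset_univ _, ?_⟩, Finset.mem_insert_self _ _⟩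
    rw [Finset.card_insert_of_notMem h.2, h.1.2]
  · rintro ⟨B, i⟩ h
    simp only [Finset.mem_sigma, Finset.mem_powersetCard, Finset.mem_compl] at h ⊢
    refine ⟨⟨Finset.subset_univ _, ?_⟩, Finset.notMem_erase _ _⟩
    rw [Finset.card_erase_of_mem h.2, h.1.2, Nat.add_sub_cancel]
  · rintro ⟨A, i⟩ h
    simp only [Finset.mem_sigma, Finset.mem_compl] at h
    simp [Finset.erase_insert h.2]
  · rintro ⟨B, i⟩ h
    simp only [Finset.mem_sigma] at h
    simp [Finset.insert_erase h.2]
  · rintro ⟨A, i⟩ h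
    simp only [Finset.mem_sigma, Finset.mem_compl] at h
    simp [Finset.prod_insert h.2]

theorem factorial_mul_choose_le_pow (N p : ℕ) :
    (p.factorial * N.choose p : ℝ) ≤ (N : ℝ) ^ p := by
  have := N.descFactorial_le_pow p
  rw [Nat.descFactorial_eq_factorial_mul_choose] at this
  exact_mod_cast this

/-- Up to monomials with a repeated variable, which are of lower order in `N`, the power of a sum
is a multiple of the elementary symmetric polynomial. -/
theorem abs_factorial_mul_elemSymm_sub_le {N : ℕ} (p : ℕ) {x : Fin N → ℝ} (hx : ∀ i, |x i| ≤ 1) :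
    |p.factorial * elemSymm p x - (∑ i, x i) ^ p| ≤ (p : ℝ) ^ 2 * (N : ℝ) ^ (p - 1) := by
  have hs : |∑ i, x i| ≤ N := by
    refine (Finset.abs_sum_le_sum_abs _ _).trans ((Finset.sum_le_sum fun i _ => hx i).trans ?_)
    simp
  induction p with
  | zero => simp [elemSymm]
  | succ p ih =>
    set R := ∑ A ∈ Finset.univ.powersetCard p, ∑ i ∈ A, x i * ∏ j ∈ A, x j with hR
    have hRb : p.factorial * |R| ≤ p * (N : ℝ) ^ p := by
      have h1 : |R| ≤ N.choose p * p := by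
        refine (Finset.abs_sum_le_sum_abs _ _).trans ?_
        have h2 : ∀ A ∈ Finset.univ.powersetCard p, |∑ i ∈ A, x i * ∏ j ∈ A, x j| ≤ p := by
          intro A hA
          refine (Finset.abs_sum_le_sum_abs _ _).trans ?_
          have h3 : ∀ i ∈ A, |x i * ∏ j ∈ A, x j| ≤ 1 := by
            intro i _
            rw [abs_mul, Finset.abs_prod]
            exact mul_le_one₀ (hx i) (Finset.prod_nonneg fun _ _ => abs_nonneg _)
              (Finset.prod_le_one (fun _ _ => abs_nonneg _) fun j _ => hx j)
          refine (Finset.sum_le_sum h3).trans ?_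
          simp [(Finset.mem_powersetCard.1 hA).2]
        refine (Finset.sum_le_sum h2).trans ?_
        simp
      have h4 := factorial_mul_choose_le_pow N p
      calc p.factorial * |R| ≤ p.factorial * (N.choose p * p) := by gcongr
        _ = (p.factorial * N.choose p) * p := by ring
        _ ≤ (N : ℝ) ^ p * p := by gcongr
        _ = _ := by ring
    have hrec : ((p + 1).factorial : ℝ) * elemSymm (p + 1) x - (∑ i, x i) ^ (p + 1) =
        (∑ i, x i) * (p.factorial * elemSymm p x - (∑ i, x i) ^ p) - p.factorial * R := by
      have := sum_mul_elemSymm p x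
      rw [← hR] at this
      rw [Nat.factorial_succ, pow_succ]
      push_cast
      linear_combination -(p.factorial : ℝ) * this
    have hN : (N : ℝ) * ((p : ℝ) ^ 2 * (N : ℝ) ^ (p - 1)) = (p : ℝ) ^ 2 * (N : ℝ) ^ p := by
      rcases p with _ | p
      · simp
      · simp only [Nat.add_sub_cancel]; ring
    rw [hrec, Nat.add_sub_cancel]
    refine (abs_sub _ _).trans ?_
    rw [abs_mul, abs_mul, Nat.abs_cast]
    have h5 := mul_le_mul hs ih (abs_nonneg _) (by positivity)
    push_cast
    have h6 : (0 : ℝ) ≤ (p + 1) * (N : ℝ) ^ p := by positivity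
    nlinarith

end Combinatorics

/-! ### The covariance of the Hamiltonian -/

section Model

variable {N : ℕ}

/-- The coefficients of the field `σ ↦ -H_N(σ, J)`. -/
noncomputable def couplingCoeff (N p : ℕ) (A : Tuple N p) (σ : Config N) : ℝ :=
  √((p.factorial : ℝ) / (2 * (N : ℝ) ^ (p - 1))) * ∏ i ∈ A.1, spin σ i

/-- The coefficients of the field `σ ↦ -β H_N(σ, J)`. -/
noncomputable def scaledCoeff (N p : ℕ) (β : ℝ) (A : Tuple N p) (σ : Config N) : ℝ :=
  β * couplingCoeff N p A σ

theorem field_scaledCoeff {p : ℕ} (β : ℝ) (J : Tuple N p → ℝ) (σ : Config N) :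
    field (scaledCoeff N p β) J σ = β * field (couplingCoeff N p) J σ := by
  simp only [field, scaledCoeff, Finset.mul_sum]
  exact Finset.sum_congr rfl fun A _ => by ring

theorem neg_mul_hamiltonian {p : ℕ} (β : ℝ) (J : Tuple N p → ℝ) (σ : Config N) :
    -β * hamiltonian J σ = field (scaledCoeff N p β) J σ := by
  rw [field_scaledCoeff]
  simp only [field, couplingCoeff, hamiltonian]
  rw [neg_mul, neg_mul, mul_neg, neg_neg, Finset.mul_sum]
  congr 1
  exact Finset.sum_congr rfl fun A _ => by ring

theorem spin_mul_self (σ : Config N) (i : Fin N) : spin σ i * spin σ i = 1 := by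
  unfold spin
  rcases Int.units_eq_one_or (σ i) with h | h <;> simp [h]

theorem abs_spin (σ : Config N) (i : Fin N) : |spin σ i| = 1 := by
  unfold spin
  rcases Int.units_eq_one_or (σ i) with h | h <;> simp [h]

theorem abs_overlap_le (σ τ : Config N) : |overlap σ τ| ≤ 1 := by
  unfold overlap
  rw [abs_div, Nat.abs_cast]
  refine div_le_one_of_le₀ ?_ (Nat.cast_nonneg _)
  refine (Finset.abs_sum_le_sum_abs _ _).trans ?_
  simp [abs_mul, abs_spin]

theorem overlap_self (hN : N ≠ 0) (σ : Config N) : overlap σ σ = 1 := by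
  unfold overlap
  have : (N : ℝ) ≠ 0 := Nat.cast_ne_zero.2 hN
  simp [spin_mul_self, this]

theorem overlap_comm (σ τ : Config N) : overlap σ τ = overlap τ σ := by
  unfold overlap
  simp only [mul_comm]

theorem abs_couplingCoeff (N p : ℕ) (A : Tuple N p) (σ : Config N) :
    |couplingCoeff N p A σ| = √((p.factorial : ℝ) / (2 * (N : ℝ) ^ (p - 1))) := by
  rw [couplingCoeff, abs_mul, Finset.abs_prod, abs_of_nonneg (Real.sqrt_nonneg _)]
  simp [abs_spin]

theorem crossCov_couplingCoeff (p : ℕ) (σ τ : Config N) :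
    crossCov (couplingCoeff N p) (couplingCoeff N p) σ τ =
      (p.factorial : ℝ) / (2 * (N : ℝ) ^ (p - 1)) * elemSymm p (fun i => spin σ i * spin τ i) := by
  have h0 : (0 : ℝ) ≤ (p.factorial : ℝ) / (2 * (N : ℝ) ^ (p - 1)) := by positivity
  rw [elemSymm, Finset.sum_subtype (p := fun A : Finset (Fin N) => A.card = p) _
    (fun A => by simp [Finset.mem_powersetCard]), Finset.mul_sum, crossCov]
  refine Finset.sum_congr rfl fun A _ => ?_
  rw [couplingCoeff, couplingCoeff, Finset.prod_mul_distrib]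
  have h1 := Real.mul_self_sqrt h0
  linear_combination (∏ i ∈ A.1, spin σ i) * (∏ i ∈ A.1, spin τ i) * h1

/-- The covariance of the energies of two configurations is `N q ^ p / 2`, up to a bounded
error. -/
theorem abs_crossCov_couplingCoeff_sub_le {p : ℕ} (hp : 2 ≤ p) (σ τ : Config N) :
    |crossCov (couplingCoeff N p) (couplingCoeff N p) σ τ - N / 2 * overlap σ τ ^ p| ≤
      (p : ℝ) ^ 2 / 2 := by
  rw [crossCov_couplingCoeff]
  rcases Nat.eq_zero_or_pos N with rfl | hN
  -- For `N = 0` both terms vanish, the first one through division by `0 ^ (p - 1) = 0`.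
  · have : p - 1 ≠ 0 := by omega
    simp only [CharP.cast_eq_zero, zero_pow this, mul_zero, div_zero, zero_mul, zero_div, sub_zero,
      abs_zero]
    positivity
  have hN' : (0 : ℝ) < N := Nat.cast_pos.2 hN
  obtain ⟨k, rfl⟩ : ∃ k, p = k + 1 := ⟨p - 1, by omega⟩
  have h := abs_factorial_mul_elemSymm_sub_le (k + 1) (x := fun i => spin σ i * spin τ i)
    (fun i => by rw [abs_mul, abs_spin, abs_spin, one_mul])
  rw [Nat.add_sub_cancel] at h ⊢
  have e : ((k + 1).factorial : ℝ) / (2 * (N : ℝ) ^ k) *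
      elemSymm (k + 1) (fun i => spin σ i * spin τ i) - N / 2 * overlap σ τ ^ (k + 1) =
      ((k + 1).factorial * elemSymm (k + 1) (fun i => spin σ i * spin τ i) -
        (∑ i, spin σ i * spin τ i) ^ (k + 1)) / (2 * (N : ℝ) ^ k) := by
    rw [overlap, div_pow]
    field_simp
    ring
  rw [e, abs_div, abs_of_pos (by positivity : (0 : ℝ) < 2 * (N : ℝ) ^ k),
    div_le_div_iff₀ (by positivity) (by positivity)]
  calc _ ≤ ((k + 1 : ℕ) : ℝ) ^ 2 * (N : ℝ) ^ k * 2 := by gcongr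
    _ = _ := by ring

theorem crossCov_scaledCoeff {p : ℕ} (β γ : ℝ) (σ τ : Config N) :
    crossCov (scaledCoeff N p β) (scaledCoeff N p γ) σ τ =
      β * γ * crossCov (couplingCoeff N p) (couplingCoeff N p) σ τ := by
  simp only [crossCov, scaledCoeff, Finset.mul_sum]
  exact Finset.sum_congr rfl fun A _ => by ring

/-- This holds for `N = 0` as well, where the overlap is `0`, so that empty blocks need no special
treatment. -/
theorem natCast_mul_overlap_self_pow (p : ℕ) (σ : Config N) : (N : ℝ) * overlap σ σ ^ p = N := by
  rcases Nat.eq_zero_or_pos N with rfl | hN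
  · simp
  · simp [overlap_self hN.ne']

/-- The sum of the squares of the coupling strengths is at most `β ^ 2 N / 2`. -/
theorem sum_sq_coupling_le {p : ℕ} (hp : 2 ≤ p) (β : ℝ) :
    ∑ _A : Tuple N p, (|β| * √((p.factorial : ℝ) / (2 * (N : ℝ) ^ (p - 1)))) ^ 2 ≤
      β ^ 2 * N / 2 := by
  have h0 : (0 : ℝ) ≤ (p.factorial : ℝ) / (2 * (N : ℝ) ^ (p - 1)) := by positivity
  simp only [mul_pow, sq_abs, Real.sq_sqrt h0, Finset.sum_const, nsmul_eq_mul]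
  have hcard : (Finset.univ : Finset (Tuple N p)).card = N.choose p := by
    rw [Finset.card_univ, Fintype.card_finset_len, Fintype.card_fin]
  rw [hcard]
  rcases Nat.eq_zero_or_pos N with rfl | hN
  · rw [Nat.choose_eq_zero_of_lt (by omega)]; simp
  have hN' : (0 : ℝ) < N := Nat.cast_pos.2 hN
  have h4 := factorial_mul_choose_le_pow N p
  obtain ⟨k, rfl⟩ : ∃ k, p = k + 1 := ⟨p - 1, by omega⟩
  rw [Nat.add_sub_cancel]
  calc ((N.choose (k + 1) : ℕ) : ℝ) * (β ^ 2 * (((k + 1).factorial : ℝ) / (2 * (N : ℝ) ^ k)))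
      = β ^ 2 * ((k + 1).factorial * N.choose (k + 1)) / (2 * (N : ℝ) ^ k) := by ring
    _ ≤ β ^ 2 * (N : ℝ) ^ (k + 1) / (2 * (N : ℝ) ^ k) := by gcongr
    _ = β ^ 2 * N / 2 := by
        field_simp
        ring

end Model

/-! ### The thermodynamic limit of the free energy -/

section ThermodynamicLimit

variable {N p : ℕ}

/-- The quenched free energy `𝔼 log Z_N(β)` of the `p`-spin model. -/
noncomputable def modelFreeEnergy (N p : ℕ) (β : ℝ) : ℝ := freeEnergy (scaledCoeff N p β)

theorem crossCov_couplingCoeff_le_self (p : ℕ) (σ τ : Config N) :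
    crossCov (couplingCoeff N p) (couplingCoeff N p) σ τ ≤
      crossCov (couplingCoeff N p) (couplingCoeff N p) σ σ := by
  refine Finset.sum_le_sum fun A _ => (le_abs_self _).trans_eq ?_
  rw [abs_mul, abs_couplingCoeff N p A τ, ← abs_couplingCoeff N p A σ, abs_mul_abs_self]

theorem abs_crossCov_couplingCoeff_le (hp : 2 ≤ p) (σ τ : Config N) :
    |crossCov (couplingCoeff N p) (couplingCoeff N p) σ τ| ≤ ((N : ℝ) + (p : ℝ) ^ 2) / 2 := by
  have h := abs_crossCov_couplingCoeff_sub_le hp σ τ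
  have h2 : |(N : ℝ) / 2 * overlap σ τ ^ p| ≤ N / 2 := by
    rw [abs_mul, abs_of_nonneg (by positivity : (0 : ℝ) ≤ (N : ℝ) / 2), abs_pow]
    exact mul_le_of_le_one_right (by positivity) (pow_le_one₀ (abs_nonneg _) (abs_overlap_le σ τ))
  have h3 := abs_sub_abs_le_abs_sub (crossCov (couplingCoeff N p) (couplingCoeff N p) σ τ)
    ((N : ℝ) / 2 * overlap σ τ ^ p)
  linarith

/-- Lowering `β` scales the covariance down, which can only lower the free energy. -/
theorem modelFreeEnergy_mono (p : ℕ) {β γ : ℝ} (hβ : 0 ≤ β) (h : β ≤ γ) :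
    modelFreeEnergy N p β ≤ modelFreeEnergy N p γ := by
  have := freeEnergy_le_of_cov_le (scaledCoeff N p γ) (scaledCoeff N p β) (d := 0) (fun σ τ => by
    simp only [crossCov_scaledCoeff]
    have h1 := crossCov_couplingCoeff_le_self p σ τ
    nlinarith [mul_le_mul h h hβ (hβ.trans h)])
  simpa [modelFreeEnergy] using this

theorem natCast_mul_overlap (σ τ : Config N) : (N : ℝ) * overlap σ τ = ∑ i, spin σ i * spin τ i := by
  unfold overlap
  rcases Nat.eq_zero_or_pos N with rfl | hN
  · simp
  · have : (N : ℝ) ≠ 0 := Nat.cast_ne_zero.2 hN.ne'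
    field_simp

/-- Splitting the sites of a system of size `m + n` into two blocks. -/
def splitConfig (m n : ℕ) : Config (m + n) ≃ Config m × Config n :=
  (Equiv.arrowCongr finSumFinEquiv.symm (Equiv.refl ℤˣ)).trans
    (Equiv.sumArrowEquivProdArrow (Fin m) (Fin n) ℤˣ)

theorem natCast_mul_overlap_split {m n : ℕ} (σ τ : Config (m + n)) :
    ((m + n : ℕ) : ℝ) * overlap σ τ =
      m * overlap (splitConfig m n σ).1 (splitConfig m n τ).1 +
      n * overlap (splitConfig m n σ).2 (splitConfig m n τ).2 := by
  rw [natCast_mul_overlap, natCast_mul_overlap, natCast_mul_overlap, Fin.sum_univ_add]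
  rfl

/-- The overlap of the whole system is a convex combination of those of the blocks; this is where
`p` even is used. -/
theorem natCast_mul_overlap_pow_le {m n : ℕ} (hp : Even p) (σ τ : Config (m + n)) :
    ((m + n : ℕ) : ℝ) * overlap σ τ ^ p ≤
      m * overlap (splitConfig m n σ).1 (splitConfig m n τ).1 ^ p +
      n * overlap (splitConfig m n σ).2 (splitConfig m n τ).2 ^ p := by
  have h := natCast_mul_overlap_split σ τ
  set q₁ := overlap (splitConfig m n σ).1 (splitConfig m n τ).1
  set q₂ := overlap (splitConfig m n σ).2 (splitConfig m n τ).2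
  rcases Nat.eq_zero_or_pos (m + n) with h0 | h0
  · obtain ⟨rfl, rfl⟩ : m = 0 ∧ n = 0 := by omega
    simp
  have hN : (0 : ℝ) < m + n := by exact_mod_cast h0
  push_cast at h ⊢
  have hc := (hp.convexOn_pow (𝕜 := ℝ)).2 (Set.mem_univ q₁) (Set.mem_univ q₂)
    (show (0 : ℝ) ≤ m / (m + n) by positivity) (show (0 : ℝ) ≤ n / (m + n) by positivity)
    (by field_simp)
  have he : (m / (m + n) : ℝ) • q₁ + (n / (m + n) : ℝ) • q₂ = overlap σ τ := by
    simp only [smul_eq_mul]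
    field_simp
    linarith
  rw [he] at hc
  simp only [smul_eq_mul] at hc
  calc ((m : ℝ) + n) * overlap σ τ ^ p
      ≤ (m + n) * (m / (m + n) * q₁ ^ p + n / (m + n) * q₂ ^ p) := by gcongr
    _ = m * q₁ ^ p + n * q₂ ^ p := by field_simp

/-- Guerra-Toninelli: the free energy is superadditive in the size, up to a constant. -/
theorem modelFreeEnergy_add_le (hp : Even p) (hp2 : 2 ≤ p) (β : ℝ) (m n : ℕ) :
    modelFreeEnergy m p β + modelFreeEnergy n p β ≤
      modelFreeEnergy (m + n) p β + 3 * β ^ 2 * (p : ℝ) ^ 2 / 2 := by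
  unfold modelFreeEnergy
  rw [← freeEnergy_prod (splitConfig m n)]
  refine freeEnergy_le_of_cov_le _ _ fun σ τ => ?_
  have hsum : ∀ σ τ : Config (m + n), crossCov
      (Sum.elim (fun A σ => scaledCoeff m p β A (splitConfig m n σ).1)
        (fun A σ => scaledCoeff n p β A (splitConfig m n σ).2))
      (Sum.elim (fun A σ => scaledCoeff m p β A (splitConfig m n σ).1)
        (fun A σ => scaledCoeff n p β A (splitConfig m n σ).2)) σ τ =
      crossCov (scaledCoeff m p β) (scaledCoeff m p β) (splitConfig m n σ).1 (splitConfig m n τ).1 +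
      crossCov (scaledCoeff n p β) (scaledCoeff n p β) (splitConfig m n σ).2 (splitConfig m n τ).2 := by
    intro σ τ
    simp [crossCov]
  simp only [hsum, crossCov_scaledCoeff]
  have a1 := abs_le.1 (abs_crossCov_couplingCoeff_sub_le hp2 σ σ)
  have a2 := abs_le.1 (abs_crossCov_couplingCoeff_sub_le hp2 σ τ)
  have b1 := abs_le.1 (abs_crossCov_couplingCoeff_sub_le hp2 (splitConfig m n σ).1
    (splitConfig m n σ).1)
  have b2 := abs_le.1 (abs_crossCov_couplingCoeff_sub_le hp2 (splitConfig m n σ).1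
    (splitConfig m n τ).1)
  have c1 := abs_le.1 (abs_crossCov_couplingCoeff_sub_le hp2 (splitConfig m n σ).2
    (splitConfig m n σ).2)
  have c2 := abs_le.1 (abs_crossCov_couplingCoeff_sub_le hp2 (splitConfig m n σ).2
    (splitConfig m n τ).2)
  have e0 := natCast_mul_overlap_self_pow p σ
  have e1 := natCast_mul_overlap_self_pow p (splitConfig m n σ).1
  have e2 := natCast_mul_overlap_self_pow p (splitConfig m n σ).2
  have hq := natCast_mul_overlap_pow_le hp σ τ
  rw [div_mul_eq_mul_div] at a1 a2 b1 b2 c1 c2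
  rw [e0] at a1
  rw [e1] at b1
  rw [e2] at c1
  push_cast at a1 a2 hq
  rw [← mul_add, ← mul_add, ← mul_sub, ← mul_sub, ← mul_sub]
  calc β * β * _ ≤ β * β * (3 * (p : ℝ) ^ 2) := by
        refine mul_le_mul_of_nonneg_left ?_ (mul_self_nonneg β)
        linarith [a1.1, a2.2, b1.2, b2.1, c1.2, c2.1]
    _ = 3 * β ^ 2 * (p : ℝ) ^ 2 := by ring

theorem modelFreeEnergy_le (hp : 2 ≤ p) (β : ℝ) :
    modelFreeEnergy N p β ≤ N * Real.log 2 + β ^ 2 * (N + (p : ℝ) ^ 2) := by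
  -- The subgradient inequality between `β` and infinite temperature.
  have h1 : ∀ J : Tuple N p → ℝ, logPartition (field (scaledCoeff N p β) J) ≤
      N * Real.log 2 + gibbs (field (scaledCoeff N p β) J)
        (fun σ : Fin 1 → Config N => field (scaledCoeff N p β) J (σ 0)) := by
    intro J
    have h := gibbs_le_logPartition_sub (field (scaledCoeff N p β) J)
      (fun σ => (-1) * field (scaledCoeff N p β) J σ)
    rw [gibbs_const_mul (n := 1) _ (-1) (fun σ => field (scaledCoeff N p β) J (σ 0))] at h
    have e : logPartition (fun σ => field (scaledCoeff N p β) J σ +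
        (-1) * field (scaledCoeff N p β) J σ) = N * Real.log 2 := by
      simp [logPartition]
    rw [e] at h
    linarith
  have hi : Integrable (fun J => gibbs (field (scaledCoeff N p β) J)
      (fun σ : Fin 1 → Config N => field (scaledCoeff N p β) J (σ 0))) (stdGaussian (Tuple N p)) :=
    integrable_gibbs_field_self _ _
  have h2 := integral_mono (integrable_logPartition_field _) ((integrable_const _).add hi) h1
  have h3 : ∫ J, gibbs (field (scaledCoeff N p β) J) (fun σ : Fin 2 → Config N =>
      crossCov (scaledCoeff N p β) (scaledCoeff N p β) (σ 0) (σ 0) -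
      crossCov (scaledCoeff N p β) (scaledCoeff N p β) (σ 0) (σ 1)) ∂stdGaussian (Tuple N p) ≤
      ∫ _ : Tuple N p → ℝ, β ^ 2 * (N + (p : ℝ) ^ 2) ∂stdGaussian (Tuple N p) := by
    refine integral_mono (integrable_gibbs_field _ _) (integrable_const _) fun J => ?_
    rw [← gibbs_const (n := 2) (field (scaledCoeff N p β) J) (β ^ 2 * (N + (p : ℝ) ^ 2))]
    refine gibbs_mono _ fun σ => ?_
    simp only [crossCov_scaledCoeff]
    have a1 := abs_le.1 (abs_crossCov_couplingCoeff_le hp (σ 0) (σ 0))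
    have a2 := abs_le.1 (abs_crossCov_couplingCoeff_le hp (σ 0) (σ 1))
    rw [← mul_sub, ← pow_two]
    exact mul_le_mul_of_nonneg_left (by linarith [a1.2, a2.1]) (sq_nonneg β)
  have h4 : ∫ J, (N * Real.log 2 + gibbs (field (scaledCoeff N p β) J)
      (fun σ : Fin 1 → Config N => field (scaledCoeff N p β) J (σ 0))) ∂stdGaussian (Tuple N p) =
      N * Real.log 2 + ∫ J, gibbs (field (scaledCoeff N p β) J)
      (fun σ : Fin 1 → Config N => field (scaledCoeff N p β) J (σ 0)) ∂stdGaussian (Tuple N p) := by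
    rw [integral_add (integrable_const _) hi]
    simp
  have h5 := h2.trans_eq h4
  rw [integral_gibbs_field] at h5
  simp only [integral_const, probReal_univ, one_smul] at h3
  unfold modelFreeEnergy freeEnergy
  linarith

/-- The limit of the free energy per spin exists. -/
theorem exists_tendsto_modelFreeEnergy_div (hp : Even p) (hp2 : 2 ≤ p) (β : ℝ) :
    ∃ ψ : ℝ, Tendsto (fun N : ℕ => modelFreeEnergy N p β / N) atTop (𝓝 ψ) := by
  set K := 3 * β ^ 2 * (p : ℝ) ^ 2 / 2 with hK
  -- Subtracting the free energy from the constant error makes the sequence exactly subadditive.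
  let u : ℕ → ℝ := fun N => K - modelFreeEnergy N p β
  have hu : Subadditive u := fun m n => by
    have := modelFreeEnergy_add_le hp hp2 β m n
    simp only [u]
    linarith
  have hbdd : BddBelow (Set.range fun N : ℕ => u N / N) := by
    refine ⟨-(Real.log 2 + β ^ 2 * (1 + (p : ℝ) ^ 2)), ?_⟩
    have hpos : 0 ≤ Real.log 2 + β ^ 2 * (1 + (p : ℝ) ^ 2) := by
      have := Real.log_nonneg one_le_two
      positivity
    rintro _ ⟨N, rfl⟩
    rcases Nat.eq_zero_or_pos N with rfl | hN
    · simp only [Nat.cast_zero, div_zero]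
      linarith
    have hN1 : (1 : ℝ) ≤ N := Nat.one_le_cast.2 hN
    have h1 := modelFreeEnergy_le (N := N) hp2 β
    have h2 : 0 ≤ K := by positivity
    simp only [u]
    rw [le_div_iff₀ (by linarith)]
    have h3 : β ^ 2 * (p : ℝ) ^ 2 ≤ β ^ 2 * (p : ℝ) ^ 2 * N :=
      le_mul_of_one_le_right (by positivity) hN1
    linarith
  refine ⟨-hu.lim, ?_⟩
  have h0 : Tendsto (fun N : ℕ => K / (N : ℝ)) atTop (𝓝 0) :=
    tendsto_const_div_atTop_nhds_zero_nat K
  have h1 := h0.sub (hu.tendsto_lim hbdd)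
  rw [zero_sub] at h1
  refine h1.congr fun N => ?_
  simp only [u]
  ring

/-- The limit of the free energy per spin. -/
noncomputable def limitFreeEnergy (p : ℕ) (β : ℝ) : ℝ :=
  limUnder atTop fun N : ℕ => modelFreeEnergy N p β / N

theorem tendsto_modelFreeEnergy_div (hp : Even p) (hp2 : 2 ≤ p) (β : ℝ) :
    Tendsto (fun N : ℕ => modelFreeEnergy N p β / N) atTop (𝓝 (limitFreeEnergy p β)) :=
  tendsto_nhds_limUnder (exists_tendsto_modelFreeEnergy_div hp hp2 β)

theorem ae_differentiableAt_limitFreeEnergy (hp : Even p) (hp2 : 2 ≤ p) :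
    ∀ᵐ β : ℝ, 0 < β → DifferentiableAt ℝ (limitFreeEnergy p) β := by
  have hmono : MonotoneOn (limitFreeEnergy p) (Set.Ioi 0) := fun β hβ γ _ h =>
    le_of_tendsto_of_tendsto' (tendsto_modelFreeEnergy_div hp hp2 β)
      (tendsto_modelFreeEnergy_div hp hp2 γ) fun N => by
        gcongr
        exact modelFreeEnergy_mono p (le_of_lt hβ) h
  filter_upwards [hmono.ae_differentiableWithinAt_of_mem] with β h hβ
  exact (h hβ).differentiableAt (Ioi_mem_nhds hβ)

end ThermodynamicLimit

/-! ### Quenched averages -/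

section Quenched

variable {N p n k : ℕ} {β : ℝ}

/-- The quenched average of an observable of `n` replicas that need not be a function of the
overlaps. -/
noncomputable def quenched (N p : ℕ) (β : ℝ) (G : (Fin n → Config N) → ℝ) : ℝ :=
  ∫ J, gibbs (field (scaledCoeff N p β) J) G ∂stdGaussian (Tuple N p)

theorem average_eq_quenched (G : (Fin n → Fin n → ℝ) → ℝ) :
    average N p β G = quenched N p β fun σ : Fin n → Config N => G fun a b => overlap (σ a) (σ b) := by
  unfold average quenched
  refine integral_congr_ae (ae_of_all _ fun J => ?_)
  have : (fun σ : Config N => -β * hamiltonian J σ) = field (scaledCoeff N p β) J :=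
    funext fun σ => neg_mul_hamiltonian β J σ
  simp only [← this]
  rfl

theorem quenched_add (G G' : (Fin n → Config N) → ℝ) :
    quenched N p β (fun σ => G σ + G' σ) = quenched N p β G + quenched N p β G' := by
  simp only [quenched, gibbs_add]
  exact integral_add (integrable_gibbs_field _ _) (integrable_gibbs_field _ _)

theorem quenched_sub (G G' : (Fin n → Config N) → ℝ) :
    quenched N p β (fun σ => G σ - G' σ) = quenched N p β G - quenched N p β G' := by
  simp only [quenched, gibbs_sub]
  exact integral_sub (integrable_gibbs_field _ _) (integrable_gibbs_field _ _)

theorem quenched_const_mul (c : ℝ) (G : (Fin n → Config N) → ℝ) :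
    quenched N p β (fun σ => c * G σ) = c * quenched N p β G := by
  simp only [quenched, gibbs_const_mul, integral_const_mul]

theorem quenched_finsetSum {α : Type*} (s : Finset α) (G : α → (Fin n → Config N) → ℝ) :
    quenched N p β (fun σ => ∑ i ∈ s, G i σ) = ∑ i ∈ s, quenched N p β (G i) := by
  simp only [quenched, gibbs_finsetSum]
  exact integral_finsetSum _ fun i _ => integrable_gibbs_field _ _

theorem quenched_comp {e : Fin k → Fin n} (he : Function.Injective e)
    (G : (Fin k → Config N) → ℝ) :
    quenched N p β (fun σ => G (σ ∘ e)) = quenched N p β G := by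
  simp only [quenched, gibbs_comp _ he]

theorem quenched_const (c : ℝ) : quenched N p β (fun _ : Fin n → Config N => c) = c := by
  simp [quenched, gibbs_const]

theorem abs_quenched_le {G : (Fin n → Config N) → ℝ} {C : ℝ} (h : ∀ σ, |G σ| ≤ C) :
    |quenched N p β G| ≤ C := by
  have := norm_integral_le_of_norm_le_const (μ := stdGaussian (Tuple N p))
    (f := fun J => gibbs (field (scaledCoeff N p β) J) G)
    (ae_of_all _ fun J => (Real.norm_eq_abs _).trans_le (abs_gibbs_le _ h))
  simpa [quenched] using this

end Quenched

/-! ### Decorrelation of the energy from bounded observables -/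

section GhirlandaGuerra

variable {N p n : ℕ}

/-- The quenched average of `G` times minus the energy of the replica `a`. -/
noncomputable def quenchedEnergy (N p : ℕ) (β : ℝ) (G : (Fin n → Config N) → ℝ) (a : Fin n) : ℝ :=
  ∫ J, gibbs (field (scaledCoeff N p β) J)
    (fun σ => G σ * field (couplingCoeff N p) J (σ a)) ∂stdGaussian (Tuple N p)

theorem quenchedEnergy_add (β : ℝ) (G G' : (Fin n → Config N) → ℝ) (a : Fin n) :
    quenchedEnergy N p β (fun σ => G σ + G' σ) a =
      quenchedEnergy N p β G a + quenchedEnergy N p β G' a := by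
  simp only [quenchedEnergy, add_mul, gibbs_add]
  exact integral_add (integrable_gibbs_mul_field _ _ _ _) (integrable_gibbs_mul_field _ _ _ _)

theorem quenchedEnergy_const_mul (β c : ℝ) (G : (Fin n → Config N) → ℝ) (a : Fin n) :
    quenchedEnergy N p β (fun σ => c * G σ) a = c * quenchedEnergy N p β G a := by
  simp only [quenchedEnergy, mul_assoc, gibbs_const_mul, integral_const_mul]

theorem quenchedEnergy_const (β c : ℝ) (a : Fin n) :
    quenchedEnergy N p β (fun _ => c) a =
      c * quenchedEnergy N p β (fun _ : Fin 1 → Config N => 1) 0 := by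
  simp only [quenchedEnergy, gibbs_const_mul, integral_const_mul, one_mul]
  congr 1
  refine integral_congr_ae (ae_of_all _ fun J => ?_)
  exact gibbs_comp _ (e := fun _ : Fin 1 => a) (fun i j _ => Subsingleton.elim i j)
    (fun σ => field (couplingCoeff N p) J (σ 0))

theorem field_scaledCoeff_add (β t : ℝ) (J : Tuple N p → ℝ) :
    (fun σ => field (scaledCoeff N p β) J σ + t * field (couplingCoeff N p) J σ) =
      field (scaledCoeff N p (β + t)) J := by
  funext σ
  simp only [field_scaledCoeff]
  ring

/-- The mean energy is a subgradient of the free energy. -/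
theorem mul_quenchedEnergy_le (β t : ℝ) :
    t * quenchedEnergy N p β (fun _ : Fin 1 → Config N => 1) 0 ≤
      modelFreeEnergy N p (β + t) - modelFreeEnergy N p β := by
  simp only [quenchedEnergy, modelFreeEnergy, freeEnergy, one_mul]
  rw [← integral_const_mul, ← integral_sub (integrable_logPartition_field _)
    (integrable_logPartition_field _)]
  refine integral_mono ((integrable_gibbs_field_self _ _).const_mul t)
    ((integrable_logPartition_field _).sub (integrable_logPartition_field _)) fun J => ?_
  have h := gibbs_le_logPartition_sub (field (scaledCoeff N p β) J)
    (fun σ => t * field (couplingCoeff N p) J σ)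
  rw [field_scaledCoeff_add] at h
  simpa only [gibbs_const_mul] using h

theorem integral_abs_logPartition_sub_modelFreeEnergy_le (hp : 2 ≤ p) (β : ℝ) :
    ∫ J, |logPartition (field (scaledCoeff N p β) J) - modelFreeEnergy N p β|
      ∂stdGaussian (Tuple N p) ≤ |β| * √N := by
  have hc : ∀ (A : Tuple N p) (σ : Config N), |scaledCoeff N p β A σ| ≤
      |β| * √((p.factorial : ℝ) / (2 * (N : ℝ) ^ (p - 1))) := fun A σ => by
    rw [scaledCoeff, abs_mul, abs_couplingCoeff]
  refine (integral_abs_logPartition_sub_le hc).trans ?_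
  have e : |β| * √(N : ℝ) = √(β ^ 2 * N) := by
    rw [Real.sqrt_mul (sq_nonneg β), Real.sqrt_sq_eq_abs]
  rw [e]
  refine Real.sqrt_le_sqrt ((sum_sq_coupling_le hp β).trans ?_)
  have : 0 ≤ β ^ 2 * (N : ℝ) := by positivity
  linarith

/-- The energy of a replica tilted by a bounded density exceeds the increment of the free energy
by at most the relative entropy of the density and the fluctuations of the free energy. -/
theorem mul_quenchedEnergy_tilted_le (hp : 2 ≤ p) (β t : ℝ) {G : (Fin n → Config N) → ℝ}
    (h1 : ∀ σ, 1 ≤ G σ) (h3 : ∀ σ, G σ ≤ 3) (a : Fin n) :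
    t * quenchedEnergy N p β G a ≤
      quenched N p β G * (modelFreeEnergy N p (β + t) - modelFreeEnergy N p β) +
        3 * (Real.log 3 + (|β + t| + |β|) * √N) := by
  set A := modelFreeEnergy N p β
  set A' := modelFreeEnergy N p (β + t)
  have i1 : Integrable (fun J => gibbs (field (scaledCoeff N p β) J) G * (A' - A))
    (stdGaussian (Tuple N p)) := (integrable_gibbs_field _ _).mul_const _
  have i2 : ∀ γ, Integrable (fun J => |logPartition (field (scaledCoeff N p γ) J) -
      modelFreeEnergy N p γ|) (stdGaussian (Tuple N p)) := fun γ =>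
    ((integrable_logPartition_field _).sub (integrable_const _)).abs
  have i3 : Integrable (fun J => 3 * (|logPartition (field (scaledCoeff N p (β + t)) J) - A'| +
      |logPartition (field (scaledCoeff N p β) J) - A|)) (stdGaussian (Tuple N p)) :=
    ((i2 (β + t)).add (i2 β)).const_mul 3
  have i4 : Integrable (fun J => 3 * Real.log 3 +
      3 * (|logPartition (field (scaledCoeff N p (β + t)) J) - A'| +
        |logPartition (field (scaledCoeff N p β) J) - A|)) (stdGaussian (Tuple N p)) :=
    (integrable_const _).add i3
  have key : ∫ J, t * gibbs (field (scaledCoeff N p β) J)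
      (fun σ => G σ * field (couplingCoeff N p) J (σ a)) ∂stdGaussian (Tuple N p) ≤
      ∫ J, (gibbs (field (scaledCoeff N p β) J) G * (A' - A) + (3 * Real.log 3 +
        3 * (|logPartition (field (scaledCoeff N p (β + t)) J) - A'| +
          |logPartition (field (scaledCoeff N p β) J) - A|))) ∂stdGaussian (Tuple N p) := by
    refine integral_mono ((integrable_gibbs_mul_field _ _ _ _).const_mul t)
      (i1.add i4) fun J => ?_
    have h := gibbs_mul_le (field (scaledCoeff N p β) J)
      (fun σ => t * field (couplingCoeff N p) J σ) h1 h3 a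
    have hg1 : 1 ≤ gibbs (field (scaledCoeff N p β) J) G := by
      rw [← gibbs_const (n := n) (field (scaledCoeff N p β) J) 1]; exact gibbs_mono _ h1
    have hg3 : gibbs (field (scaledCoeff N p β) J) G ≤ 3 := by
      rw [← gibbs_const (n := n) (field (scaledCoeff N p β) J) 3]; exact gibbs_mono _ h3
    rw [field_scaledCoeff_add] at h
    have e : gibbs (field (scaledCoeff N p β) J)
        (fun σ => G σ * (t * field (couplingCoeff N p) J (σ a))) =
        t * gibbs (field (scaledCoeff N p β) J)
          (fun σ => G σ * field (couplingCoeff N p) J (σ a)) := by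
      rw [← gibbs_const_mul]
      congr 1
      funext σ
      ring
    rw [e] at h
    refine h.trans ?_
    set g := gibbs (field (scaledCoeff N p β) J) G
    set L := logPartition (field (scaledCoeff N p β) J)
    set L' := logPartition (field (scaledCoeff N p (β + t)) J)
    have b1 : g * Real.log 3 ≤ 3 * Real.log 3 :=
      mul_le_mul_of_nonneg_right hg3 (Real.log_nonneg (by norm_num))
    have b2 : g * (L' - A' - (L - A)) ≤ 3 * (|L' - A'| + |L - A|) := by
      refine (le_abs_self _).trans ?_
      rw [abs_mul, abs_of_nonneg (by linarith : 0 ≤ g)]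
      exact mul_le_mul hg3 (abs_sub _ _) (abs_nonneg _) (by norm_num)
    calc g * (Real.log 3 + (L' - L)) = g * (A' - A) + (g * Real.log 3 + g * (L' - A' - (L - A))) := by
          ring
      _ ≤ g * (A' - A) + (3 * Real.log 3 + 3 * (|L' - A'| + |L - A|)) := by linarith
  have k3 : ∫ J, 3 * (|logPartition (field (scaledCoeff N p (β + t)) J) - A'| +
      |logPartition (field (scaledCoeff N p β) J) - A|) ∂stdGaussian (Tuple N p) =
      3 * (∫ J, |logPartition (field (scaledCoeff N p (β + t)) J) - A'| ∂stdGaussian (Tuple N p) +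
        ∫ J, |logPartition (field (scaledCoeff N p β) J) - A| ∂stdGaussian (Tuple N p)) := by
    rw [integral_const_mul, integral_add (i2 (β + t)) (i2 β)]
  rw [integral_const_mul, integral_add i1 i4,
    integral_add (integrable_const _) i3, integral_mul_const, k3] at key
  simp only [integral_const, probReal_univ, one_smul] at key
  have c1 := integral_abs_logPartition_sub_modelFreeEnergy_le (N := N) hp (β + t)
  have c2 := integral_abs_logPartition_sub_modelFreeEnergy_le (N := N) hp β
  unfold quenchedEnergy quenched
  linarith

/-- The energy of a replica is asymptotically uncorrelated with bounded observables wherever the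
symmetric second difference of the free energy is small. -/
theorem abs_quenchedEnergy_sub_le (hp : 2 ≤ p) (β : ℝ) {t : ℝ} {F : (Fin n → Config N) → ℝ}
    (hF : ∀ σ, |F σ| ≤ 1) (a : Fin n) :
    t * |quenchedEnergy N p β F a -
        quenched N p β F * quenchedEnergy N p β (fun _ : Fin 1 → Config N => 1) 0| ≤
      3 * (modelFreeEnergy N p (β + t) + modelFreeEnergy N p (β - t) - 2 * modelFreeEnergy N p β) +
        3 * (Real.log 3 + (|β + t| + |β|) * √N) := by
  set e := quenchedEnergy N p β (fun _ : Fin 1 → Config N => 1) 0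
  have m1 : t * e ≤ _ := mul_quenchedEnergy_le β t
  have m2 : (-t) * e ≤ _ := mul_quenchedEnergy_le β (-t)
  rw [← sub_eq_add_neg] at m2
  set A := modelFreeEnergy N p β
  set A' := modelFreeEnergy N p (β + t)
  set A₀ := modelFreeEnergy N p (β - t)
  -- The tilted bound for the densities `2 + F` and `2 - F`.
  have main : ∀ s : ℝ, |s| = 1 → t * (s * (quenchedEnergy N p β F a - quenched N p β F * e)) ≤
      3 * (A' + A₀ - 2 * A) + 3 * (Real.log 3 + (|β + t| + |β|) * √N) := by
    intro s hs
    have hsF : ∀ σ, |s * F σ| ≤ 1 := fun σ => by rw [abs_mul, hs, one_mul]; exact hF σ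
    have h := mul_quenchedEnergy_tilted_le hp β t (G := fun σ => 2 + s * F σ)
      (fun σ => by linarith [(abs_le.1 (hsF σ)).1]) (fun σ => by linarith [(abs_le.1 (hsF σ)).2]) a
    rw [quenchedEnergy_add, quenchedEnergy_const, quenchedEnergy_const_mul, quenched_add,
      quenched_const, quenched_const_mul] at h
    have hq : |s * quenched N p β F| ≤ 1 := by
      rw [abs_mul, hs, one_mul]; exact abs_quenched_le hF
    have hq2 := (abs_le.1 hq).2
    have hq1 := (abs_le.1 hq).1
    set f := quenched N p β F
    have b1 : (2 + s * f) * (A - A₀) ≤ (2 + s * f) * (t * e) :=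
      mul_le_mul_of_nonneg_left (by linarith) (by linarith)
    have b2 : (2 + s * f) * (A' + A₀ - 2 * A) ≤ 3 * (A' + A₀ - 2 * A) :=
      mul_le_mul_of_nonneg_right (by linarith) (by linarith)
    linarith
  have p1 := main 1 (by norm_num)
  have p2 := main (-1) (by norm_num)
  rcases abs_choice (quenchedEnergy N p β F a - quenched N p β F * e) with h | h <;> rw [h]
  · simpa using p1
  · simpa using p2

/-- Integration by parts for the energy of a replica, with the covariance replaced by the power of
the overlap. -/
theorem abs_quenchedEnergy_sub_overlap_le (hp : 2 ≤ p) {β : ℝ} (hβ : 0 ≤ β)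
    {F : (Fin n → Config N) → ℝ} (hF : ∀ σ, |F σ| ≤ 1) (a : Fin n) :
    |quenchedEnergy N p β F a - β * (N / 2) *
      quenched N p β (fun σ : Fin (n + 1) → Config N => F (fun b => σ b.castSucc) *
        (∑ b : Fin n, overlap (σ a.castSucc) (σ b.castSucc) ^ p -
          n * overlap (σ a.castSucc) (σ (Fin.last n)) ^ p))| ≤ β * (n * (p : ℝ) ^ 2) := by
  have h : quenchedEnergy N p β F a = quenched N p β (fun σ : Fin (n + 1) → Config N =>
      F (fun b => σ b.castSucc) * (∑ b : Fin n,
        crossCov (couplingCoeff N p) (scaledCoeff N p β) (σ a.castSucc) (σ b.castSucc) -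
        n * crossCov (couplingCoeff N p) (scaledCoeff N p β) (σ a.castSucc) (σ (Fin.last n)))) :=
    integral_gibbs_mul_field (couplingCoeff N p) (scaledCoeff N p β) F a
  have hcov : ∀ σ τ : Config N, crossCov (couplingCoeff N p) (scaledCoeff N p β) σ τ =
      β * crossCov (couplingCoeff N p) (couplingCoeff N p) σ τ := by
    intro σ τ
    simp only [crossCov, scaledCoeff, Finset.mul_sum]
    exact Finset.sum_congr rfl fun A _ => by ring
  rw [h, ← quenched_const_mul, ← quenched_sub]
  refine abs_quenched_le fun σ => ?_
  simp only [hcov]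
  set c : Config N → Config N → ℝ := crossCov (couplingCoeff N p) (couplingCoeff N p)
  have e : F (fun b => σ b.castSucc) * (∑ b : Fin n, β * c (σ a.castSucc) (σ b.castSucc) -
        n * (β * c (σ a.castSucc) (σ (Fin.last n)))) -
      β * (N / 2) * (F (fun b => σ b.castSucc) *
        (∑ b : Fin n, overlap (σ a.castSucc) (σ b.castSucc) ^ p -
          n * overlap (σ a.castSucc) (σ (Fin.last n)) ^ p)) =
      F (fun b => σ b.castSucc) * (β * (∑ b : Fin n, (c (σ a.castSucc) (σ b.castSucc) -
        N / 2 * overlap (σ a.castSucc) (σ b.castSucc) ^ p) -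
        n * (c (σ a.castSucc) (σ (Fin.last n)) -
          N / 2 * overlap (σ a.castSucc) (σ (Fin.last n)) ^ p))) := by
    rw [Finset.sum_sub_distrib, ← Finset.mul_sum, ← Finset.mul_sum]
    ring
  rw [e, abs_mul]
  refine (mul_le_of_le_one_left (abs_nonneg _) (hF _)).trans ?_
  rw [abs_mul, abs_of_nonneg hβ]
  refine mul_le_mul_of_nonneg_left ?_ hβ
  have s1 : |∑ b : Fin n, (c (σ a.castSucc) (σ b.castSucc) -
      N / 2 * overlap (σ a.castSucc) (σ b.castSucc) ^ p)| ≤ n * ((p : ℝ) ^ 2 / 2) := by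
    refine (Finset.abs_sum_le_sum_abs _ _).trans ((Finset.sum_le_sum fun b _ =>
      abs_crossCov_couplingCoeff_sub_le hp _ _).trans_eq ?_)
    simp
  have s2 : |n * (c (σ a.castSucc) (σ (Fin.last n)) -
      N / 2 * overlap (σ a.castSucc) (σ (Fin.last n)) ^ p)| ≤ n * ((p : ℝ) ^ 2 / 2) := by
    rw [abs_mul, Nat.abs_cast]
    exact mul_le_mul_of_nonneg_left (abs_crossCov_couplingCoeff_sub_le hp _ _) (Nat.cast_nonneg _)
  refine (abs_sub _ _).trans ?_
  linarith

/-- The Ghirlanda-Guerra functional of `n` replicas: the observable `F` of the first `n` replicas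
times the centred energy of the replica `a`, after integration by parts. -/
noncomputable def ghirlandaGuerra (N p : ℕ) (β : ℝ) (F : (Fin n → Config N) → ℝ) (a : Fin n) : ℝ :=
  quenched N p β fun σ : Fin (n + 1) → Config N => F (fun b => σ b.castSucc) *
    (∑ b : Fin n, overlap (σ a.castSucc) (σ b.castSucc) ^ p -
      n * overlap (σ a.castSucc) (σ (Fin.last n)) ^ p -
      (1 - quenched N p β fun σ : Fin 2 → Config N => overlap (σ 0) (σ 1) ^ p))

theorem mul_abs_ghirlandaGuerra_le (hp : 2 ≤ p) (hN : N ≠ 0) {β : ℝ} (hβ : 0 ≤ β) {t : ℝ}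
    (ht : 0 ≤ t) {F : (Fin n → Config N) → ℝ} (hF : ∀ σ, |F σ| ≤ 1) (a : Fin n) :
    t * (β * (N / 2) * |ghirlandaGuerra N p β F a|) ≤
      3 * (modelFreeEnergy N p (β + t) + modelFreeEnergy N p (β - t) - 2 * modelFreeEnergy N p β) +
        3 * (Real.log 3 + (|β + t| + |β|) * √N) + t * (β * ((n + 1) * (p : ℝ) ^ 2)) := by
  have h1 := abs_quenchedEnergy_sub_overlap_le hp hβ hF a
  have h2 := abs_quenchedEnergy_sub_overlap_le hp hβ
    (F := fun _ : Fin 1 → Config N => 1) (fun _ => by simp) 0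
  have h3 := abs_quenchedEnergy_sub_le hp β (t := t) hF a
  have e2 : quenched N p β (fun σ : Fin (1 + 1) → Config N => (1 : ℝ) *
        (∑ b : Fin 1, overlap (σ (0 : Fin 1).castSucc) (σ b.castSucc) ^ p -
          (1 : ℕ) * overlap (σ (0 : Fin 1).castSucc) (σ (Fin.last 1)) ^ p)) =
      1 - quenched N p β fun σ : Fin 2 → Config N => overlap (σ 0) (σ 1) ^ p := by
    have h := quenched_sub (N := N) (p := p) (β := β) (fun _ : Fin 2 → Config N => 1)
      (fun σ => overlap (σ 0) (σ 1) ^ p)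
    rw [quenched_const] at h
    rw [← h]
    congr 1
    funext σ
    simp [overlap_self hN]
  rw [e2] at h2
  set m := quenched N p β fun σ : Fin 2 → Config N => overlap (σ 0) (σ 1) ^ p with hm
  set e := quenchedEnergy N p β (fun _ : Fin 1 → Config N => 1) 0
  set y := quenchedEnergy N p β F a
  set f := quenched N p β F
  set Q := quenched N p β (fun σ : Fin (n + 1) → Config N => F (fun b => σ b.castSucc) *
        (∑ b : Fin n, overlap (σ a.castSucc) (σ b.castSucc) ^ p -
          n * overlap (σ a.castSucc) (σ (Fin.last n)) ^ p)) with hQ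
  have hX : ghirlandaGuerra N p β F a = Q - (1 - m) * f := by
    have hf' : f = quenched N p β (fun σ : Fin (n + 1) → Config N => F (fun b => σ b.castSucc)) :=
      (quenched_comp (Fin.castSucc_injective n) F).symm
    rw [hf', ← quenched_const_mul, hQ, ← quenched_sub]
    unfold ghirlandaGuerra
    congr 1
    funext σ
    rw [← hm]
    ring
  have hf1 : |f| ≤ 1 := abs_quenched_le hF
  have b : β * (N / 2) * |ghirlandaGuerra N p β F a| ≤ |y - f * e| + β * ((n + 1) * (p : ℝ) ^ 2) := by
    have e1 : β * (N / 2) * (Q - (1 - m) * f) =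
        (y - f * e) - (y - β * (N / 2) * Q) + f * (e - β * (N / 2) * (1 - m)) := by ring
    have hpos : 0 ≤ β * ((N : ℝ) / 2) := by positivity
    have e3 : β * (N / 2) * |ghirlandaGuerra N p β F a| =
        |β * (N / 2) * ghirlandaGuerra N p β F a| := by rw [abs_mul, abs_of_nonneg hpos]
    rw [e3, hX, e1]
    refine (abs_add_le _ _).trans ?_
    have c1 := abs_sub (y - f * e) (y - β * (N / 2) * Q)
    have c2 : |f * (e - β * (N / 2) * (1 - m))| ≤ β * ((1 : ℕ) * (p : ℝ) ^ 2) := by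
      rw [abs_mul]
      exact (mul_le_of_le_one_left (abs_nonneg _) hf1).trans h2
    push_cast at c2
    linarith
  calc _ ≤ t * (|y - f * e| + β * ((n + 1) * (p : ℝ) ^ 2)) := mul_le_mul_of_nonneg_left b ht
    _ ≤ _ := by linarith

/-- The symmetric second difference of a function at a point of differentiability. -/
theorem tendsto_symmetric_difference {f : ℝ → ℝ} {x : ℝ} (hf : DifferentiableAt ℝ f x) :
    Tendsto (fun t => t⁻¹ * (f (x + t) + f (x - t) - 2 * f x)) (𝓝[>] 0) (𝓝 0) := by
  have hd := hf.hasDerivAt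
  have h1 : HasDerivAt (fun t => f (x + t) + f (x - t)) 0 0 := by
    have a1 : HasDerivAt (fun t => f (x + t)) (deriv f x) 0 := by
      refine HasDerivAt.comp_const_add x 0 ?_
      simpa using hd
    have a2 : HasDerivAt (fun t => f (x - t)) (-deriv f x) 0 := by
      refine HasDerivAt.comp_const_sub x 0 ?_
      simpa using hd
    exact (a1.fun_add a2).congr_deriv (by simp)
  refine h1.tendsto_slope_zero_right.congr fun t => ?_
  simp only [zero_add, add_zero, sub_zero, smul_eq_mul]
  ring

/-- The Ghirlanda-Guerra identities in the form of a single replica's energy: they hold wherever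
the limiting free energy is differentiable. -/
theorem tendsto_ghirlandaGuerra (hp : Even p) (hp2 : 2 ≤ p) {β : ℝ} (hβ : 0 < β)
    (hd : DifferentiableAt ℝ (limitFreeEnergy p) β) {F : ∀ N, (Fin n → Config N) → ℝ}
    (hF : ∀ N σ, |F N σ| ≤ 1) (a : Fin n) :
    Tendsto (fun N => ghirlandaGuerra N p β (F N) a) atTop (𝓝 0) := by
  let ψ : ℕ → ℝ → ℝ := fun N γ => modelFreeEnergy N p γ / N
  -- The bound of `mul_abs_ghirlandaGuerra_le`, solved for the functional.
  let B : ℝ → ℕ → ℝ := fun t N => 2 / β * (3 * (t⁻¹ * (ψ N (β + t) + ψ N (β - t) - 2 * ψ N β)) +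
    3 * t⁻¹ * (Real.log 3 / N + (|β + t| + |β|) * (√N)⁻¹) + β * ((n + 1) * (p : ℝ) ^ 2) / N)
  have hB : ∀ t, 0 < t → Tendsto (B t) atTop (𝓝 (2 / β * (3 * (t⁻¹ * (limitFreeEnergy p (β + t) +
      limitFreeEnergy p (β - t) - 2 * limitFreeEnergy p β))))) := by
    intro t _
    have l1 := tendsto_modelFreeEnergy_div hp hp2 (β + t)
    have l2 := tendsto_modelFreeEnergy_div hp hp2 (β - t)
    have l3 := tendsto_modelFreeEnergy_div hp hp2 β
    have l4 : Tendsto (fun N : ℕ => Real.log 3 / (N : ℝ)) atTop (𝓝 0) :=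
      tendsto_const_div_atTop_nhds_zero_nat _
    have l5 : Tendsto (fun N : ℕ => (√(N : ℝ))⁻¹) atTop (𝓝 0) :=
      tendsto_inv_atTop_zero.comp (Real.tendsto_sqrt_atTop.comp tendsto_natCast_atTop_atTop)
    have l6 : Tendsto (fun N : ℕ => β * ((n + 1) * (p : ℝ) ^ 2) / (N : ℝ)) atTop (𝓝 0) :=
      tendsto_const_div_atTop_nhds_zero_nat _
    have := ((((((l1.add l2).sub (l3.const_mul 2)).const_mul t⁻¹).const_mul 3).add
      ((l4.add (l5.const_mul (|β + t| + |β|))).const_mul (3 * t⁻¹))).add l6).const_mul (2 / β)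
    simpa only [mul_zero, add_zero] using this
  have hle : ∀ t, 0 < t → ∀ N : ℕ, N ≠ 0 → |ghirlandaGuerra N p β (F N) a| ≤ B t N := by
    intro t ht N hN
    have h := mul_abs_ghirlandaGuerra_le hp2 hN hβ.le ht.le (hF N) a
    have hN' : (0 : ℝ) < N := Nat.cast_pos.2 (Nat.pos_of_ne_zero hN)
    have hs : √(N : ℝ) = N * (√(N : ℝ))⁻¹ := by
      rw [← div_eq_mul_inv, Real.div_sqrt]
    have e : B t N = 2 / (β * t * N) * (3 * (modelFreeEnergy N p (β + t) +
        modelFreeEnergy N p (β - t) - 2 * modelFreeEnergy N p β) +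
        3 * (Real.log 3 + (|β + t| + |β|) * √N) + t * (β * ((n + 1) * (p : ℝ) ^ 2))) := by
      rw [hs]
      simp only [B, ψ]
      field_simp
    rw [e]
    calc |ghirlandaGuerra N p β (F N) a| = 2 / (β * t * N) *
          (t * (β * (N / 2) * |ghirlandaGuerra N p β (F N) a|)) := by field_simp
      _ ≤ _ := mul_le_mul_of_nonneg_left h (by positivity)
  have hlim : Tendsto (fun t => 2 / β * (3 * (t⁻¹ * (limitFreeEnergy p (β + t) +
      limitFreeEnergy p (β - t) - 2 * limitFreeEnergy p β)))) (𝓝[>] 0) (𝓝 0) := by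
    simpa using ((tendsto_symmetric_difference hd).const_mul 3).const_mul (2 / β)
  -- First `t` is chosen small, then `N` large depending on `t`.
  rw [Metric.tendsto_atTop']
  intro ε hε
  obtain ⟨t, ht, ht0⟩ := ((hlim.eventually (gt_mem_nhds hε)).and self_mem_nhdsWithin).exists
  obtain ⟨M, hM⟩ := eventually_atTop.1 ((hB t ht0).eventually (gt_mem_nhds ht))
  refine ⟨M, fun N hN => ?_⟩
  rw [Real.dist_eq, sub_zero]
  exact (hle t ht0 N (by omega)).trans_lt (hM N hN.le)

end GhirlandaGuerra

/-! ### The Ghirlanda-Guerra and Aizenman-Contucci identities -/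

section Identities

variable {N p n s : ℕ} {β : ℝ}

theorem tendsto_ghirlandaGuerra_of_bounded (hp : Even p) (hp2 : 2 ≤ p) (hβ : 0 < β)
    (hd : DifferentiableAt ℝ (limitFreeEnergy p) β) {F : ∀ N, (Fin n → Config N) → ℝ} {C : ℝ}
    (hF : ∀ N σ, |F N σ| ≤ C) (a : Fin n) :
    Tendsto (fun N => ghirlandaGuerra N p β (F N) a) atTop (𝓝 0) := by
  have hC : 0 < max C 1 := lt_max_of_lt_right one_pos
  have h := (tendsto_ghirlandaGuerra hp hp2 hβ hd (F := fun N σ => (max C 1)⁻¹ * F N σ)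
    (fun N σ => by
      rw [abs_mul, abs_of_pos (inv_pos.2 hC)]
      exact (inv_mul_le_one₀ hC).2 ((hF N σ).trans (le_max_left _ _))) a).const_mul (max C 1)
  rw [mul_zero] at h
  refine h.congr fun N => ?_
  unfold ghirlandaGuerra
  rw [← quenched_const_mul]
  congr 1
  funext σ
  rw [← mul_assoc, ← mul_assoc, mul_inv_cancel₀ hC.ne', one_mul]

/-- The observable of the first Ghirlanda-Guerra identity, with `m` in place of `⟨q₁₂ ^ p⟩`. -/
noncomputable def firstObservable (p : ℕ) (F : (Fin s → Fin s → ℝ) → ℝ) (m : ℝ) (a : Fin s)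
    (q : Fin (s + 2) → Fin (s + 2) → ℝ) : ℝ :=
  F (restrict q) * ((∑ b : Fin s, q (old a) (old b) ^ p) - (s : ℝ) * q (old a) (new₁ s) ^ p -
    (1 - m))

/-- The observable of the second Ghirlanda-Guerra identity, with `m` in place of `⟨q₁₂ ^ p⟩`. -/
noncomputable def secondObservable (p : ℕ) (F : (Fin s → Fin s → ℝ) → ℝ) (m : ℝ)
    (q : Fin (s + 2) → Fin (s + 2) → ℝ) : ℝ :=
  F (restrict q) * ((∑ b : Fin s, q (old b) (new₁ s) ^ p) + m -
    ((s : ℝ) + 1) * q (new₁ s) (new₂ s) ^ p)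

/-- The mean of `q₁₂ ^ p`. -/
noncomputable def meanOverlapPow (N p : ℕ) (β : ℝ) : ℝ :=
  average N p β fun r : Fin 2 → Fin 2 → ℝ => r 0 1 ^ p

theorem average_firstObservable (F : (Fin s → Fin s → ℝ) → ℝ) (a : Fin s) :
    average N p β (firstObservable p F (meanOverlapPow N p β) a) =
      ghirlandaGuerra N p β (fun σ => F fun a b => overlap (σ a) (σ b)) a := by
  rw [meanOverlapPow, average_eq_quenched, average_eq_quenched]
  exact quenched_comp (Fin.castSucc_injective (s + 1)) fun σ : Fin (s + 1) → Config N =>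
    F (fun a b => overlap (σ a.castSucc) (σ b.castSucc)) *
      (∑ b : Fin s, overlap (σ a.castSucc) (σ b.castSucc) ^ p -
        s * overlap (σ a.castSucc) (σ (Fin.last s)) ^ p -
        (1 - quenched N p β fun σ : Fin 2 → Config N => overlap (σ 0) (σ 1) ^ p))

/-- The second identity is the first one for the replica `s + 1`, on which `F` does not depend. -/
theorem average_secondObservable (hN : N ≠ 0) (F : (Fin s → Fin s → ℝ) → ℝ) :
    average N p β (secondObservable p F (meanOverlapPow N p β)) =
      ghirlandaGuerra N p β (fun σ : Fin (s + 1) → Config N =>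
        F fun a b => overlap (σ a.castSucc) (σ b.castSucc)) (Fin.last s) := by
  rw [meanOverlapPow, average_eq_quenched, average_eq_quenched]
  unfold ghirlandaGuerra
  congr 1
  funext σ
  rw [Fin.sum_univ_castSucc, overlap_self hN, one_pow]
  have h : ∀ b : Fin s, overlap (σ (Fin.last s).castSucc) (σ b.castSucc.castSucc) =
      overlap (σ (old b)) (σ (new₁ s)) := fun b => overlap_comm _ _
  simp only [h]
  have h2 : overlap (σ (Fin.last s).castSucc) (σ (Fin.last (s + 1))) =
      overlap (σ (new₁ s)) (σ (new₂ s)) := rfl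
  rw [h2, Nat.cast_add, Nat.cast_one]
  unfold secondObservable
  congr 1
  ring

theorem tendsto_average_firstObservable (hp : Even p) (hp2 : 2 ≤ p) (hβ : 0 < β)
    (hd : DifferentiableAt ℝ (limitFreeEnergy p) β) {F : (Fin s → Fin s → ℝ) → ℝ}
    (hF : IsBoundedObservable F) (a : Fin s) :
    Tendsto (fun N => average N p β (firstObservable p F (meanOverlapPow N p β) a)) atTop
      (𝓝 0) := by
  obtain ⟨C, hC⟩ := hF
  simp only [average_firstObservable]
  exact tendsto_ghirlandaGuerra_of_bounded hp hp2 hβ hd (C := C)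
    (fun N σ => hC _ fun a b => abs_overlap_le _ _) a

theorem tendsto_average_secondObservable (hp : Even p) (hp2 : 2 ≤ p) (hβ : 0 < β)
    (hd : DifferentiableAt ℝ (limitFreeEnergy p) β) {F : (Fin s → Fin s → ℝ) → ℝ}
    (hF : IsBoundedObservable F) :
    Tendsto (fun N => average N p β (secondObservable p F (meanOverlapPow N p β))) atTop
      (𝓝 0) := by
  obtain ⟨C, hC⟩ := hF
  refine (tendsto_ghirlandaGuerra_of_bounded hp hp2 hβ hd (C := C)
    (F := fun N (σ : Fin (s + 1) → Config N) =>
      F fun a b => overlap (σ a.castSucc) (σ b.castSucc))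
    (fun N σ => hC _ fun a b => abs_overlap_le _ _) (Fin.last s)).congr' ?_
  filter_upwards [eventually_ne_atTop 0] with N hN
  exact (average_secondObservable hN F).symm

/-- The observable of the Aizenman-Contucci identities. -/
noncomputable def stabilityObservable (p : ℕ) (F : (Fin s → Fin s → ℝ) → ℝ)
    (q : Fin (s + 2) → Fin (s + 2) → ℝ) : ℝ :=
  F (restrict q) * ((∑ a : Fin s, ∑ b ∈ Finset.Ioi a, q (old a) (old b) ^ p) -
    (s : ℝ) * ∑ a : Fin s, q (old a) (new₁ s) ^ p +
    (s : ℝ) * ((s : ℝ) + 1) / 2 * q (new₁ s) (new₂ s) ^ p)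

theorem sum_sum_eq_two_mul_sum_Ioi {g : Fin s → Fin s → ℝ} (hg : ∀ a b, g a b = g b a) :
    ∑ a, ∑ b, g a b = ∑ a, g a a + 2 * ∑ a, ∑ b ∈ Finset.Ioi a, g a b := by
  have h1 : ∀ a, ∑ b, g a b = g a a + ∑ b ∈ Finset.Ioi a, g a b + ∑ b ∈ Finset.Iio a, g a b := by
    intro a
    have hu : (Finset.univ : Finset (Fin s)) = insert a (Finset.Ioi a ∪ Finset.Iio a) := by
      ext b
      simp only [Finset.mem_univ, Finset.mem_insert, Finset.mem_union, Finset.mem_Ioi,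
        Finset.mem_Iio, true_iff]
      rcases lt_trichotomy a b with h | h | h
      · exact Or.inr (Or.inl h)
      · exact Or.inl h.symm
      · exact Or.inr (Or.inr h)
    rw [hu, Finset.sum_insert (by simp), Finset.sum_union, add_assoc]
    rw [Finset.disjoint_left]
    intro b hb hb'
    exact lt_asymm (Finset.mem_Ioi.1 hb) (Finset.mem_Iio.1 hb')
  have h2 : ∑ a, ∑ b ∈ Finset.Iio a, g a b = ∑ a, ∑ b ∈ Finset.Ioi a, g a b := by
    rw [Finset.sum_comm' (t' := Finset.univ) (s' := fun b => Finset.Ioi b) (fun a b => by simp)]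
    exact Finset.sum_congr rfl fun a _ => Finset.sum_congr rfl fun b _ => hg _ _
  simp only [h1, Finset.sum_add_distrib, h2]
  ring

/-- The Aizenman-Contucci observable is a linear combination of the Ghirlanda-Guerra ones, in
which the mean of `q₁₂ ^ p` cancels. -/
theorem stabilityObservable_eq {q : Fin (s + 2) → Fin (s + 2) → ℝ} (hq : ∀ a b, q a b = q b a)
    (hq1 : ∀ a, q a a = 1) (F : (Fin s → Fin s → ℝ) → ℝ) (m : ℝ) :
    stabilityObservable p F q =
      2⁻¹ * ((∑ a, firstObservable p F m a q) - s * secondObservable p F m q) := by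
  simp only [stabilityObservable, firstObservable, secondObservable]
  rw [← Finset.mul_sum, Finset.sum_sub_distrib, Finset.sum_sub_distrib,
    sum_sum_eq_two_mul_sum_Ioi (g := fun a b => q (old a) (old b) ^ p) fun a b => by rw [hq]]
  simp only [hq1, one_pow, Finset.sum_const, Finset.card_univ, Fintype.card_fin, nsmul_eq_mul,
    mul_one, ← Finset.mul_sum]
  ring

theorem average_stabilityObservable (hN : N ≠ 0) (F : (Fin s → Fin s → ℝ) → ℝ) (m : ℝ) :
    average N p β (stabilityObservable p F) =
      2⁻¹ * ((∑ a, average N p β (firstObservable p F m a)) -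
        s * average N p β (secondObservable p F m)) := by
  simp only [average_eq_quenched]
  rw [← quenched_finsetSum, ← quenched_const_mul, ← quenched_sub, ← quenched_const_mul]
  congr 1
  funext σ
  exact stabilityObservable_eq (fun a b => overlap_comm _ _) (fun a => overlap_self hN _) F m

theorem tendsto_average_stabilityObservable (hp : Even p) (hp2 : 2 ≤ p) (hβ : 0 < β)
    (hd : DifferentiableAt ℝ (limitFreeEnergy p) β) {F : (Fin s → Fin s → ℝ) → ℝ}
    (hF : IsBoundedObservable F) :
    Tendsto (fun N => average N p β (stabilityObservable p F)) atTop (𝓝 0) := by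
  have h1 := tendsto_finsetSum (Finset.univ : Finset (Fin s)) fun a _ =>
    tendsto_average_firstObservable hp hp2 hβ hd hF a
  have h2 := (h1.sub ((tendsto_average_secondObservable hp hp2 hβ hd hF).const_mul
    (s : ℝ))).const_mul 2⁻¹
  simp only [Finset.sum_const_zero, mul_zero, sub_zero] at h2
  refine h2.congr' ?_
  filter_upwards [eventually_ne_atTop 0] with N hN
  exact (average_stabilityObservable hN F _).symm

theorem isBoundedObservable_monomial (m : Fin s → Fin s → ℕ) :
    IsBoundedObservable (monomial m) := by
  refine ⟨1, fun q hq => ?_⟩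
  unfold monomial
  rw [Finset.abs_prod]
  refine Finset.prod_le_one (fun _ _ => abs_nonneg _) fun a _ => ?_
  rw [Finset.abs_prod]
  refine Finset.prod_le_one (fun _ _ => abs_nonneg _) fun b _ => ?_
  rw [abs_pow]
  exact pow_le_one₀ (abs_nonneg _) (hq a b)

/-- For `F = q₁₂ ^ p`, exchangeability of the replicas brings the Aizenman-Contucci identity to
its usual form. -/
theorem average_stabilityObservable_pow (N p : ℕ) (β : ℝ) :
    average N p β (stabilityObservable p fun q : Fin 2 → Fin 2 → ℝ => q 0 1 ^ p) =
      average N p β (fun q : Fin 2 → Fin 2 → ℝ => q 0 1 ^ (2 * p))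
      - 4 * average N p β (fun q : Fin 3 → Fin 3 → ℝ => q 0 1 ^ p * q 0 2 ^ p)
      + 3 * average N p β (fun q : Fin 4 → Fin 4 → ℝ => q 0 1 ^ p * q 2 3 ^ p) := by
  simp only [average_eq_quenched]
  have e1 := quenched_comp (N := N) (p := p) (β := β) (e := ![(0 : Fin 4), 1]) (by decide)
    (fun σ : Fin 2 → Config N => overlap (σ 0) (σ 1) ^ (2 * p))
  have e2 := quenched_comp (N := N) (p := p) (β := β) (e := ![(0 : Fin 4), 1, 2]) (by decide)
    (fun σ : Fin 3 → Config N => overlap (σ 0) (σ 1) ^ p * overlap (σ 0) (σ 2) ^ p)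
  have e3 := quenched_comp (N := N) (p := p) (β := β) (e := ![(1 : Fin 4), 0, 2]) (by decide)
    (fun σ : Fin 3 → Config N => overlap (σ 0) (σ 1) ^ p * overlap (σ 0) (σ 2) ^ p)
  have e4 : ∀ x y z : ℝ, x - 4 * y + 3 * z = x - (2 * y + 2 * y) + 3 * z := fun x y z => by ring
  rw [e4]
  nth_rewrite 1 [← e2]
  rw [← e1, ← e3, ← quenched_const_mul, ← quenched_const_mul, ← quenched_const_mul,
    ← quenched_add, ← quenched_sub, ← quenched_add]
  congr 1
  funext σ
  have hI0 : Finset.Ioi (0 : Fin 2) = {1} := by decide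
  have hI1 : Finset.Ioi (1 : Fin 2) = ∅ := by decide
  have o0 : (old (0 : Fin 2) : Fin 4) = 0 := rfl
  have o1 : (old (1 : Fin 2) : Fin 4) = 1 := rfl
  have o2 : new₁ 2 = (2 : Fin 4) := rfl
  have o3 : new₂ 2 = (3 : Fin 4) := rfl
  simp only [stabilityObservable, restrict, Fin.sum_univ_two, hI0, hI1, Finset.sum_singleton,
    Finset.sum_empty, o0, o1, o2, o3, Function.comp_apply, Matrix.cons_val_zero,
    Matrix.cons_val_one, Matrix.cons_val, overlap_comm (σ 1) (σ 0)]
  push_cast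
  ring

end Identities

end PSpin

theorem mainTheorem7 (p : ℕ) (hp : Even p) (hp2 : 2 ≤ p) :
    ∀ᵐ β : ℝ, 0 < β →
      -- Aizenman-Contucci: filled monomials `F_s` of the overlaps among `s` replicas
      (∀ (s : ℕ) (m : Fin s → Fin s → ℕ), PSpin.IsFilled m →
        Tendsto (fun N : ℕ => PSpin.average N p β
          fun q : Fin (s + 2) → Fin (s + 2) → ℝ =>
            PSpin.monomial m (PSpin.restrict q) *
              ((∑ a : Fin s, ∑ b ∈ Finset.Ioi a, q (PSpin.old a) (PSpin.old b) ^ p)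
                - (s : ℝ) * ∑ a : Fin s, q (PSpin.old a) (PSpin.new₁ s) ^ p
                + (s : ℝ) * ((s : ℝ) + 1) / 2 * q (PSpin.new₁ s) (PSpin.new₂ s) ^ p))
          atTop (𝓝 0)) ∧
      -- the first Aizenman-Contucci relation
      Tendsto (fun N : ℕ =>
          PSpin.average N p β (fun q : Fin 2 → Fin 2 → ℝ => q 0 1 ^ (2 * p))
          - 4 * PSpin.average N p β (fun q : Fin 3 → Fin 3 → ℝ => q 0 1 ^ p * q 0 2 ^ p)
          + 3 * PSpin.average N p β (fun q : Fin 4 → Fin 4 → ℝ => q 0 1 ^ p * q 2 3 ^ p))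
        atTop (𝓝 0) ∧
      -- the two Ghirlanda-Guerra forms
      (∀ (s : ℕ) (F : (Fin s → Fin s → ℝ) → ℝ), PSpin.IsBoundedObservable F →
        (∀ a : Fin s, Tendsto (fun N : ℕ => PSpin.average N p β
          fun q : Fin (s + 2) → Fin (s + 2) → ℝ =>
            F (PSpin.restrict q) *
              ((∑ b : Fin s, q (PSpin.old a) (PSpin.old b) ^ p)
                - (s : ℝ) * q (PSpin.old a) (PSpin.new₁ s) ^ p
                - (1 - PSpin.average N p β fun r : Fin 2 → Fin 2 → ℝ => r 0 1 ^ p)))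
          atTop (𝓝 0)) ∧
        Tendsto (fun N : ℕ => PSpin.average N p β
          fun q : Fin (s + 2) → Fin (s + 2) → ℝ =>
            F (PSpin.restrict q) *
              ((∑ b : Fin s, q (PSpin.old b) (PSpin.new₁ s) ^ p)
                + (PSpin.average N p β fun r : Fin 2 → Fin 2 → ℝ => r 0 1 ^ p)
                - ((s : ℝ) + 1) * q (PSpin.new₁ s) (PSpin.new₂ s) ^ p))
          atTop (𝓝 0)) := by
  filter_upwards [PSpin.ae_differentiableAt_limitFreeEnergy hp hp2] with β hβd hβ
  have hd := hβd hβ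
  refine ⟨fun s m _ => ?_, ?_, fun s F hF => ⟨fun a => ?_, ?_⟩⟩
  · exact PSpin.tendsto_average_stabilityObservable hp hp2 hβ hd
      (PSpin.isBoundedObservable_monomial m)
  · simp only [← PSpin.average_stabilityObservable_pow]
    refine PSpin.tendsto_average_stabilityObservable hp hp2 hβ hd ⟨1, fun q hq => ?_⟩
    rw [abs_pow]
    exact pow_le_one₀ (abs_nonneg _) (hq 0 1)
  · exact PSpin.tendsto_average_firstObservable hp hp2 hβ hd hF a
  · exact PSpin.tendsto_average_secondObservable hp hp2 hβ hd hF
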